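/- Let $w\ge 1$ be a fixed integer. A graph is the complement of a matching if, in its complement, every vertex has at most one neighbour (the matching need not be perfect and may be empty). For $n \ge 1$, let $g_w(n)$ be the number of labelled graphs on the vertex set $\{1,\dots,n\}$ whose vertex set can be partitioned into $w$ (possibly empty) parts, each of which induces the complement of a matching. Then, as $n\to\infty$, $$g_w(n)=\Theta\left(\frac{w^n}{n^{(w-1)/2}}\left(\frac{n}{ew}\right)^{n/2}e^{\sqrt{nw}}\,2^{\left(1-\frac1w\right)\frac{n^2}{2}}\right),$$ that is, there are constants $0<c\le C$ and $N$, depending only on $w$, such that for all $n\ge N$ the number $g_w(n)$ lies between $c$ and $C$ times the expression in parentheses. -/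

import Mathlib

open Filter Asymptotics

/-- A graph whose edges form a matching: no two distinct edges share an endpoint, that is, every
vertex has at most one neighbour. The matching need not be perfect and may be empty. -/
def IsMatchingGraph {V : Type*} (H : SimpleGraph V) : Prop :=
  ∀ v : V, (H.neighborSet v).Subsingleton

/-- A graph that is the complement of a matching on its vertex set. -/
def IsCoMatching {V : Type*} (H : SimpleGraph V) : Prop :=
  IsMatchingGraph Hᶜ

/-- The vertex set of `G` can be partitioned into `w` parts (the fibres of `part`, some of which may
be empty), each inducing in `G` the complement of a matching. -/
def CoMatchingPartitionable {V : Type*} (w : ℕ) (G : SimpleGraph V) : Prop :=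
  ∃ part : V → Fin w, ∀ i : Fin w, IsCoMatching (G.induce {v | part v = i})

/-- The number of (labelled) graphs on a set of `n` vertices that can be partitioned into `w` parts,
each inducing the complement of a matching. -/
noncomputable def coMatchingPartitionableCount (w n : ℕ) : ℕ :=
  {G : SimpleGraph (Fin n) | CoMatchingPartitionable w G}.ncard

/-! Count pairs (graph, partition), then show that a typical graph has boundedly many partitions.
Fix a partition with class sizes `k_i`, write `m k` for the number of matchings on `k` vertices, and
put `a = n / w`. The graphs compatible with it are given by a matching in each class and arbitrary
cross edges, so there are `∏ m(k_i) * 2 ^ e` of them with `e = (1 - 1/w) n²/2 - ∑ (k_i - a)²/2`.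
There are `n! / ∏ k_i!` partitions with these sizes, so each size vector contributes `n! * 2 ^ ((1 -
1/w) n²/2)` times the product of the weights `m(k_i) / k_i! * 2 ^ (-(k_i - a)²/2)`.

The number of matchings satisfies the same two-term recurrence as a Gaussian moment, whence `m k ≍
(k/e)^(k/2) e^√k` (`matchingCount_bounds`). With Stirling, `m k / k!` is `exp (classExponent k) /
√(k+1)` up to constants. The exponent is concave; its tangent at `a` has linear terms that cancel
because `∑ k_i = n`. What remains is summed against the Gaussian `2 ^ (-(k - a)²/2)` with a bound
independent of `n`. This gives the upper bound (`coMatchingPartitionableCount_le`).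

For the lower bound the balanced size vector alone suffices. All but a small proportion of its
graphs are rigid, and a rigid graph determines its partition up to renaming classes
(`IsRigid.exists_eq_comp`), so no graph is counted more than `w ^ w` times
(`le_coMatchingPartitionableCount`). Finally `unsimplifiedRate_isTheta` puts the common order of
magnitude in closed form. -/

/-! ### Matchings and their recurrence. -/

lemma isMatchingGraph_iff {V : Type*} {H : SimpleGraph V} :
    IsMatchingGraph H ↔ ∀ ⦃v a b⦄, H.Adj v a → H.Adj v b → a = b :=
  ⟨fun h v _ _ ha hb => h v ha hb, fun h _ _ ha _ hb => h ha hb⟩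

/-- The number of matchings (as graphs) on a vertex type. -/
noncomputable def numMatchings (V : Type*) : ℕ :=
  Nat.card {H : SimpleGraph V // IsMatchingGraph H}

lemma isMatchingGraph_comap {V W : Type*} (f : V → W) (hf : Function.Injective f)
    {H : SimpleGraph W} (h : IsMatchingGraph H) : IsMatchingGraph (H.comap f) := by
  rw [isMatchingGraph_iff] at *
  intro v a b ha hb
  exact hf (h ha hb)

lemma isMatchingGraph_comap_equiv {V W : Type*} (e : V ≃ W) {H : SimpleGraph W} :
    IsMatchingGraph (H.comap e) ↔ IsMatchingGraph H := by
  refine ⟨fun h => ?_, isMatchingGraph_comap e e.injective⟩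
  have := isMatchingGraph_comap e.symm e.symm.injective h
  rwa [SimpleGraph.comap_comap, Equiv.self_comp_symm, SimpleGraph.comap_id] at this

lemma numMatchings_congr {V W : Type*} (e : V ≃ W) : numMatchings V = numMatchings W :=
  Nat.card_congr <| (Equiv.simpleGraph e).subtypeEquiv fun H => by
    simp only [Equiv.simpleGraph_apply]
    exact (isMatchingGraph_comap_equiv e.symm).symm

/-- Extend a graph by one vertex, joined to the vertices of `S`. -/
def optionGraph {α : Type*} (H : SimpleGraph α) (S : Set α) : SimpleGraph (Option α) where
  Adj x y := match x, y with
    | none, none => False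
    | none, some a => a ∈ S
    | some a, none => a ∈ S
    | some a, some b => H.Adj a b
  symm := ⟨by rintro (_ | a) (_ | b) h <;> first | exact h | exact SimpleGraph.Adj.symm (G := H) h⟩
  loopless := ⟨by rintro (_ | a) h <;> first | exact h | exact H.loopless.irrefl a h⟩

section
variable {α : Type*} (H : SimpleGraph α) (S : Set α)
@[simp] lemma optionGraph_none_some (a : α) : (optionGraph H S).Adj none (some a) ↔ a ∈ S := Iff.rfl
@[simp] lemma optionGraph_some_none (a : α) : (optionGraph H S).Adj (some a) none ↔ a ∈ S := Iff.rfl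
@[simp] lemma optionGraph_some_some (a b : α) :
    (optionGraph H S).Adj (some a) (some b) ↔ H.Adj a b := Iff.rfl
end

/-- Matchings of `Option α` leaving `none` uncovered are the matchings of `α`. -/
def matchingEquivNone (α : Type*) :
    {H : SimpleGraph (Option α) // IsMatchingGraph H ∧ ∀ x, ¬ H.Adj none x} ≃
      {H : SimpleGraph α // IsMatchingGraph H} where
  toFun H := ⟨H.1.comap some, isMatchingGraph_comap _ (Option.some_injective _) H.2.1⟩
  invFun H := ⟨optionGraph H.1 ∅, by
    have h := isMatchingGraph_iff.1 H.2
    refine ⟨isMatchingGraph_iff.2 ?_, ?_⟩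
    · rintro (_ | v) (_ | a) (_ | b) <;> simp
      intro h1 h2
      exact h h1 h2
    · rintro (_ | v) <;> simp⟩
  left_inv := by
    rintro ⟨H, h1, h2⟩
    ext (_ | a) (_ | b)
    · simp
    · simpa using h2 _
    · simpa using fun h => h2 _ h.symm
    · simp
  right_inv := by
    rintro ⟨H, h⟩
    ext a b
    simp

/-- Matchings of `Option α` covering `none` by the edge to `a` are the matchings of `α` leaving
`a` uncovered. -/
def matchingEquivSome {α : Type*} (c : α) :
    {H : SimpleGraph (Option α) // IsMatchingGraph H ∧ H.Adj none (some c)} ≃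
      {H : SimpleGraph α // IsMatchingGraph H ∧ ∀ x, ¬ H.Adj c x} where
  toFun H := ⟨H.1.comap some, isMatchingGraph_comap _ (Option.some_injective _) H.2.1, by
    intro x hx
    have := isMatchingGraph_iff.1 H.2.1 H.2.2.symm hx
    simp at this⟩
  invFun H := ⟨optionGraph H.1 {c}, by
    have h := isMatchingGraph_iff.1 H.2.1
    have h' := H.2.2
    refine ⟨isMatchingGraph_iff.2 ?_, by simp⟩
    rintro (_ | v) (_ | a) (_ | b) <;> simp
    · rintro rfl rfl; rfl
    · rintro rfl; exact h' _
    · rintro h1 rfl; exact h' _ h1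
    · intro h1 h2
      exact h h1 h2⟩
  left_inv := by
    rintro ⟨H, h1, h2⟩
    rw [isMatchingGraph_iff] at h1
    have key : ∀ a, a = c ↔ H.Adj none (some a) := fun a =>
      ⟨by rintro rfl; exact h2, fun h => by simpa using h1 h h2⟩
    ext (_ | a) (_ | b)
    · simp
    · simp [key]
    · simp [key, H.adj_comm]
    · simp
  right_inv := by
    rintro ⟨H, h⟩
    ext a b
    simp

/-- The equivalence `e` lets any vertex `v` play the role of the added point `none`. -/
lemma card_matching_isolated {V α : Type*} (e : V ≃ Option α) (v : V) (hv : e v = none) :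
    Nat.card {H : SimpleGraph V // IsMatchingGraph H ∧ ∀ x, ¬ H.Adj v x} = numMatchings α := by
  rw [numMatchings, ← Nat.card_congr (matchingEquivNone α)]
  refine Nat.card_congr <| (Equiv.simpleGraph e).subtypeEquiv fun H => ?_
  simp only [Equiv.simpleGraph_apply]
  refine and_congr (isMatchingGraph_comap_equiv e.symm).symm ?_
  rw [← hv]
  simp only [SimpleGraph.comap_adj, Equiv.symm_apply_apply]
  exact e.symm.forall_congr_right.symm

/-- Split by the partner of `none`: either it has none, or it is some `a`, and then `a` is isolated
in the matching left on `α`. -/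
lemma numMatchings_option (α : Type*) [Finite α] :
    numMatchings (Option α) = numMatchings α +
      ∑ᶠ a : α, Nat.card {H : SimpleGraph α // IsMatchingGraph H ∧ ∀ x, ¬ H.Adj a x} := by
  classical
  have := Fintype.ofFinite α
  let f : {H : SimpleGraph (Option α) // IsMatchingGraph H ∧ ∀ x, ¬ H.Adj none x} ⊕
      (Σ a : α, {H : SimpleGraph (Option α) // IsMatchingGraph H ∧ H.Adj none (some a)}) →
      {H : SimpleGraph (Option α) // IsMatchingGraph H} :=
    Sum.elim (fun H => ⟨H.1, H.2.1⟩) (fun H => ⟨H.2.1, H.2.2.1⟩)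
  have hf : Function.Bijective f := by
    refine ⟨?_, ?_⟩
    · rintro (⟨H, h, h'⟩ | ⟨a, H, h, h'⟩) (⟨K, k, k'⟩ | ⟨b, K, k, k'⟩) e
      all_goals
        obtain rfl : H = K := congrArg Subtype.val e
      · rfl
      · exact absurd k' (h' _)
      · exact absurd h' (k' _)
      · obtain rfl : a = b := by simpa using isMatchingGraph_iff.1 h h' k'
        rfl
    · rintro ⟨H, h⟩
      by_cases hh : ∃ a, H.Adj none (some a)
      · obtain ⟨a, ha⟩ := hh
        exact ⟨Sum.inr ⟨a, H, h, ha⟩, rfl⟩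
      · refine ⟨Sum.inl ⟨H, h, ?_⟩, rfl⟩
        rintro (_ | x) hx
        exacts [H.loopless.irrefl _ hx, hh ⟨x, hx⟩]
  rw [numMatchings, ← Nat.card_congr (Equiv.ofBijective f hf), Nat.card_sum, Nat.card_congr (matchingEquivNone α),
    Nat.card_sigma, finsum_eq_sum_of_fintype]
  congr 1
  exact Finset.sum_congr rfl fun a _ => Nat.card_congr (matchingEquivSome a)

/-- The number of matchings on `n` labelled vertices. -/
noncomputable def matchingCount (n : ℕ) : ℕ := numMatchings (Fin n)

lemma numMatchings_eq (V : Type*) [Finite V] : numMatchings V = matchingCount (Nat.card V) :=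
  numMatchings_congr (Finite.equivFin V)

lemma matchingCount_zero : matchingCount 0 = 1 := by
  have : Unique {H : SimpleGraph (Fin 0) // IsMatchingGraph H} :=
    { default := ⟨⊥, fun v => v.elim0⟩, uniq := fun H => by ext v; exact v.elim0 }
  exact Nat.card_unique

lemma matchingCount_add_two (n : ℕ) :
    matchingCount (n + 2) = matchingCount (n + 1) + (n + 1) * matchingCount n := by
  have h1 : numMatchings (Option (Fin (n + 1))) = matchingCount (n + 2) := by
    rw [numMatchings_eq]; simp
  rw [← h1, numMatchings_option, finsum_eq_sum_of_fintype]
  congr 1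
  rw [Finset.sum_congr rfl (fun a _ => card_matching_isolated (finSuccEquiv' a) a (by simp))]
  simp [matchingCount]

/-! ### Order of magnitude of the number of matchings. -/

/-- The growth rate `(n / e) ^ (n / 2) * exp (√n)` of the number of matchings. -/
noncomputable def matchingRate (n : ℕ) : ℝ :=
  Real.exp (n / 2 * Real.log n - n / 2 + Real.sqrt n)

lemma matchingRate_pos (n : ℕ) : 0 < matchingRate n := Real.exp_pos _

lemma sub_sq_div_two_le_log_one_add {u : ℝ} (hu : 0 ≤ u) : u - u ^ 2 / 2 ≤ Real.log (1 + u) := by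
  refine le_trans ?_ (Real.le_log_one_add_of_nonneg hu)
  rw [le_div_iff₀ (by positivity)]
  nlinarith [pow_nonneg hu 3]

/-- Bound `log t` by its tangent at `√n` and complete the square; the resulting Gaussian is centred
at `√n + 1`. -/
lemma pow_mul_exp_le {n : ℕ} (hn : 1 ≤ n) {t : ℝ} (ht : 0 < t) :
    t ^ n * Real.exp (-(t - 1) ^ 2 / 2) ≤
      matchingRate n * Real.exp (-(1 / 2) * (t - (Real.sqrt n + 1)) ^ 2) := by
  have hn' : (0 : ℝ) < n := by exact_mod_cast hn
  set m := Real.sqrt n with hm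
  have hm0 : 0 < m := Real.sqrt_pos.2 hn'
  have hmm : (n : ℝ) = m ^ 2 := (Real.sq_sqrt hn'.le).symm
  have h1 : Real.log t ≤ Real.log m + (t / m - 1) := by
    rw [← sub_le_iff_le_add', ← Real.log_div ht.ne' hm0.ne']
    exact Real.log_le_sub_one_of_pos (by positivity)
  have h2 : Real.log n = 2 * Real.log m := by rw [hmm, Real.log_pow]; norm_num
  have h3 : t ^ n = Real.exp (n * Real.log t) := by
    rw [mul_comm, Real.exp_mul, Real.exp_log ht, Real.rpow_natCast]
  rw [matchingRate, h3, ← Real.exp_add, ← Real.exp_add, Real.exp_le_exp, h2, ← hm]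
  have h4 : (n : ℝ) * Real.log t ≤ n * (Real.log m + (t / m - 1)) :=
    mul_le_mul_of_nonneg_left h1 hn'.le
  have h5 : (n : ℝ) * (t / m) = m * t := by rw [hmm]; field_simp
  nlinarith

/-- The second-order lower bound for `log` at `√n` loses only a constant on an interval of length
one, which is enough mass for the integral. -/
lemma le_pow_mul_exp {n : ℕ} (hn : 1 ≤ n) {t : ℝ} (h1 : Real.sqrt n ≤ t)
    (h2 : t ≤ Real.sqrt n + 1) :
    matchingRate n * Real.exp (-1) ≤ t ^ n * Real.exp (-(t - 1) ^ 2 / 2) := by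
  have hn' : (0 : ℝ) < n := by exact_mod_cast hn
  set m := Real.sqrt n with hm
  have hm0 : 0 < m := Real.sqrt_pos.2 hn'
  have ht : 0 < t := hm0.trans_le h1
  have hmm : (n : ℝ) = m ^ 2 := (Real.sq_sqrt hn'.le).symm
  have h0 : (t - m) / m - ((t - m) / m) ^ 2 / 2 ≤ Real.log t - Real.log m := by
    rw [← Real.log_div ht.ne' hm0.ne']
    convert sub_sq_div_two_le_log_one_add (div_nonneg (sub_nonneg.2 h1) hm0.le) using 2
    field_simp; ring
  have h2' : Real.log n = 2 * Real.log m := by rw [hmm, Real.log_pow]; norm_num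
  have h3 : t ^ n = Real.exp (n * Real.log t) := by
    rw [mul_comm, Real.exp_mul, Real.exp_log ht, Real.rpow_natCast]
  rw [matchingRate, h3, ← Real.exp_add, ← Real.exp_add, Real.exp_le_exp, h2', ← hm]
  have h4 := mul_le_mul_of_nonneg_left h0 hn'.le
  have h5 : (n : ℝ) * ((t - m) / m - ((t - m) / m) ^ 2 / 2) = m * (t - m) - (t - m) ^ 2 / 2 := by
    rw [hmm]; field_simp
  rw [h5] at h4
  nlinarith [mul_nonneg (sub_nonneg.2 h1) (sub_nonneg.2 h2)]

/-- The moment integral satisfying the same recurrence as the number of matchings. -/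
noncomputable def shiftedGaussianMoment (n : ℕ) : ℝ :=
  ∫ t in Set.Ioi (0 : ℝ), t ^ n * Real.exp (-(t - 1) ^ 2 / 2)

lemma integrable_shifted_gaussian (a : ℝ) :
    MeasureTheory.Integrable fun t : ℝ => Real.exp (-(1 / 2) * (t - a) ^ 2) :=
  (integrable_exp_neg_mul_sq (b := 1 / 2) (by norm_num)).comp_sub_right a

lemma integrableOn_pow_mul_exp {n : ℕ} (hn : 1 ≤ n) :
    MeasureTheory.IntegrableOn (fun t : ℝ => t ^ n * Real.exp (-(t - 1) ^ 2 / 2))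
      (Set.Ioi 0) := by
  refine MeasureTheory.Integrable.mono'
    (((integrable_shifted_gaussian (Real.sqrt n + 1)).const_mul (matchingRate n)).integrableOn)
    (Continuous.aestronglyMeasurable (by fun_prop)) ?_
  filter_upwards [MeasureTheory.ae_restrict_mem measurableSet_Ioi] with t ht
  have ht : 0 < t := ht
  rw [Real.norm_of_nonneg (by positivity)]
  exact pow_mul_exp_le hn ht

lemma shiftedGaussianMoment_le {n : ℕ} (hn : 1 ≤ n) :
    shiftedGaussianMoment n ≤ matchingRate n * Real.sqrt (2 * Real.pi) := by
  have hi := (integrable_shifted_gaussian (Real.sqrt n + 1)).const_mul (matchingRate n)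
  calc shiftedGaussianMoment n
      ≤ ∫ t in Set.Ioi (0 : ℝ),
          matchingRate n * Real.exp (-(1 / 2) * (t - (Real.sqrt n + 1)) ^ 2) :=
        MeasureTheory.setIntegral_mono_on (integrableOn_pow_mul_exp hn) hi.integrableOn
          measurableSet_Ioi fun t ht => pow_mul_exp_le hn ht
    _ ≤ ∫ t, matchingRate n * Real.exp (-(1 / 2) * (t - (Real.sqrt n + 1)) ^ 2) :=
        MeasureTheory.setIntegral_le_integral hi
          (Eventually.of_forall fun t => by have := matchingRate_pos n; simp; positivity)
    _ = matchingRate n * Real.sqrt (2 * Real.pi) := by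
        rw [MeasureTheory.integral_const_mul,
          MeasureTheory.integral_sub_right_eq_self (fun t : ℝ => Real.exp (-(1 / 2) * t ^ 2)),
          integral_gaussian]
        congr 2
        ring

lemma le_shiftedGaussianMoment {n : ℕ} (hn : 1 ≤ n) :
    matchingRate n * Real.exp (-1) ≤ shiftedGaussianMoment n := by
  have hsub : Set.Ioc (Real.sqrt n) (Real.sqrt n + 1) ⊆ Set.Ioi 0 := fun t ht =>
    lt_of_le_of_lt (Real.sqrt_nonneg _) ht.1
  calc matchingRate n * Real.exp (-1)
      = ∫ t in Set.Ioc (Real.sqrt n) (Real.sqrt n + 1), matchingRate n * Real.exp (-1) := by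
        simp
    _ ≤ ∫ t in Set.Ioc (Real.sqrt n) (Real.sqrt n + 1), t ^ n * Real.exp (-(t - 1) ^ 2 / 2) :=
        MeasureTheory.setIntegral_mono_on continuous_const.integrableOn_Ioc
          ((integrableOn_pow_mul_exp hn).mono_set hsub) measurableSet_Ioc
          fun t ht => le_pow_mul_exp hn ht.1.le ht.2
    _ ≤ shiftedGaussianMoment n := by
        refine MeasureTheory.setIntegral_mono_set (integrableOn_pow_mul_exp hn) ?_
          hsub.eventuallyLE
        filter_upwards [MeasureTheory.ae_restrict_mem measurableSet_Ioi] with t ht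
        have ht : 0 < t := ht
        simp only [Pi.zero_apply]
        positivity

lemma shiftedGaussianMoment_pos {n : ℕ} (hn : 1 ≤ n) : 0 < shiftedGaussianMoment n :=
  (mul_pos (matchingRate_pos n) (Real.exp_pos _)).trans_le (le_shiftedGaussianMoment hn)

/-- Integrate the derivative of `t ^ (n + 1) * exp (-(t - 1)² / 2)` over the half-line: the function
vanishes at both ends. -/
lemma shiftedGaussianMoment_add_two {n : ℕ} (hn : 1 ≤ n) :
    shiftedGaussianMoment (n + 2) =
      shiftedGaussianMoment (n + 1) + (n + 1) * shiftedGaussianMoment n := by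
  have i0 := integrableOn_pow_mul_exp hn
  have i1 := integrableOn_pow_mul_exp (n := n + 1) (by omega)
  have i2 := integrableOn_pow_mul_exp (n := n + 2) (by omega)
  have hd : ∀ x ∈ Set.Ici (0 : ℝ),
      HasDerivAt (fun t : ℝ => t ^ (n + 1) * Real.exp (-(t - 1) ^ 2 / 2))
        ((n + 1) * (x ^ n * Real.exp (-(x - 1) ^ 2 / 2)) +
          x ^ (n + 1) * Real.exp (-(x - 1) ^ 2 / 2)
          - x ^ (n + 2) * Real.exp (-(x - 1) ^ 2 / 2)) x := by
    intro x _
    have h1 : HasDerivAt (fun t : ℝ => -(t - 1) ^ 2 / 2) (-(x - 1)) x := by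
      refine (((((hasDerivAt_id x).sub_const 1).pow 2).neg).div_const 2).congr_deriv ?_
      simp only [id_eq]
      ring
    refine ((hasDerivAt_pow (n + 1) x).mul h1.exp).congr_deriv ?_
    push_cast
    ring
  have ht : Tendsto (fun t : ℝ => t ^ (n + 1) * Real.exp (-(t - 1) ^ 2 / 2)) atTop (nhds 0) := by
    set a := Real.sqrt (n + 1 : ℕ) + 1 with ha
    have h2 : Tendsto (fun t : ℝ => matchingRate (n + 1) * Real.exp (-(1 / 2) * (t - a) ^ 2))
        atTop (nhds (matchingRate (n + 1) * 0)) := by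
      refine Tendsto.const_mul _ (Real.tendsto_exp_atBot.comp ?_)
      refine Tendsto.const_mul_atTop_of_neg (by norm_num) ?_
      exact (tendsto_pow_atTop two_ne_zero).comp (tendsto_atTop_add_const_right _ (-a) tendsto_id)
    rw [mul_zero] at h2
    refine squeeze_zero' ?_ ?_ h2
    · filter_upwards [eventually_gt_atTop 0] with t ht
      positivity
    · filter_upwards [eventually_gt_atTop 0] with t ht
      exact pow_mul_exp_le (by omega) ht
  have key := MeasureTheory.integral_Ioi_of_hasDerivAt_of_tendsto' hd
    (((i0.const_mul _).add i1).sub i2) ht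
  have e1 := MeasureTheory.integral_sub ((i0.const_mul ((n : ℝ) + 1)).add i1) i2
  have e2 := MeasureTheory.integral_add (i0.const_mul ((n : ℝ) + 1)) i1
  rw [MeasureTheory.integral_const_mul] at e2
  simp only [Pi.add_apply] at e1 e2
  rw [e1, e2, zero_pow (Nat.succ_ne_zero n)] at key
  simp only [shiftedGaussianMoment]
  linarith

lemma matchingCount_pos (n : ℕ) : 0 < matchingCount n := by
  have : Nonempty {H : SimpleGraph (Fin n) // IsMatchingGraph H} :=
    ⟨⊥, fun v => by simp⟩
  exact Nat.card_pos

/-- Positive sequences satisfying the recurrence `u (n + 2) = u (n + 1) + (n + 1) * u n` have the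
same order of magnitude. -/
lemma recurrence_comparison {u v : ℕ → ℝ} (hu : ∀ n, 1 ≤ n → u (n + 2) = u (n + 1) + (n + 1) * u n)
    (hv : ∀ n, 1 ≤ n → v (n + 2) = v (n + 1) + (n + 1) * v n) (hu0 : ∀ n, 1 ≤ n → 0 < u n)
    (hv0 : ∀ n, 1 ≤ n → 0 < v n) : ∃ C : ℝ, 0 < C ∧ ∀ n, 1 ≤ n → u n ≤ C * v n := by
  -- The sum of the two initial ratios dominates each of them, and the recurrence, having
  -- nonnegative coefficients, propagates the inequality.
  refine ⟨u 1 / v 1 + u 2 / v 2, add_pos (div_pos (hu0 1 le_rfl) (hv0 1 le_rfl))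
    (div_pos (hu0 2 (by omega)) (hv0 2 (by omega))), ?_⟩
  set C := u 1 / v 1 + u 2 / v 2 with hC
  have u1 := hu0 1 le_rfl
  have v1 := hv0 1 le_rfl
  have u2 := hu0 2 (by omega)
  have v2 := hv0 2 (by omega)
  have key : ∀ n, u (n + 1) ≤ C * v (n + 1) ∧ u (n + 2) ≤ C * v (n + 2) := by
    intro n
    induction n with
    | zero =>
      constructor
      · rw [← div_le_iff₀ v1]
        have := div_pos u2 v2
        simp only [zero_add, hC]; linarith
      · rw [← div_le_iff₀ v2]
        have := div_pos u1 v1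
        simp only [zero_add, hC]; linarith
    | succ n ih =>
      refine ⟨ih.2, ?_⟩
      rw [hu (n + 1) (by omega), hv (n + 1) (by omega)]
      have : ((n + 1 : ℕ) + 1 : ℝ) * u (n + 1) ≤ ((n + 1 : ℕ) + 1 : ℝ) * (C * v (n + 1)) :=
        mul_le_mul_of_nonneg_left ih.1 (by positivity)
      linarith [ih.2]
  intro n hn
  obtain ⟨k, rfl⟩ := Nat.exists_eq_add_of_le' hn
  exact (key k).1

/-- The number of matchings on `n` vertices has order of magnitude `(n / e) ^ (n / 2) * exp (√n)`. -/
theorem matchingCount_bounds : ∃ c C : ℝ, 0 < c ∧ 0 < C ∧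
    ∀ n, c * matchingRate n ≤ matchingCount n ∧ (matchingCount n : ℝ) ≤ C * matchingRate n := by
  have hrec : ∀ n, 1 ≤ n → (matchingCount (n + 2) : ℝ) =
      matchingCount (n + 1) + (n + 1) * matchingCount n := fun n _ => by
    exact_mod_cast matchingCount_add_two n
  have hpos : ∀ n, 1 ≤ n → (0 : ℝ) < matchingCount n := fun n _ => by
    exact_mod_cast matchingCount_pos n
  obtain ⟨C₁, hC₁, h₁⟩ := recurrence_comparison hrec (fun n hn => shiftedGaussianMoment_add_two hn)
    hpos (fun n hn => shiftedGaussianMoment_pos hn)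
  obtain ⟨C₂, hC₂, h₂⟩ := recurrence_comparison (fun n hn => shiftedGaussianMoment_add_two hn) hrec
    (fun n hn => shiftedGaussianMoment_pos hn) hpos
  -- Here `Real.log 0 = 0` is used. The `min 1` and `max 1` in the constants serve the case `n = 0`,
  -- which the integral bounds exclude.
  have h0 : matchingRate 0 = 1 := by simp [matchingRate]
  refine ⟨min 1 (Real.exp (-1) / C₂), max 1 (C₁ * Real.sqrt (2 * Real.pi)), by positivity,
    by positivity, fun n => ?_⟩
  rcases Nat.eq_zero_or_pos n with rfl | hn
  · simp [h0, matchingCount_zero]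
  have hr := matchingRate_pos n
  constructor
  · calc _ ≤ Real.exp (-1) / C₂ * matchingRate n := by gcongr; exact min_le_right _ _
      _ = (matchingRate n * Real.exp (-1)) / C₂ := by ring
      _ ≤ matchingCount n := by
        rw [div_le_iff₀' hC₂]
        exact (le_shiftedGaussianMoment hn).trans (h₂ n hn)
  · calc (matchingCount n : ℝ) ≤ C₁ * (matchingRate n * Real.sqrt (2 * Real.pi)) :=
        (h₁ n hn).trans (by gcongr; exact shiftedGaussianMoment_le hn)
      _ = C₁ * Real.sqrt (2 * Real.pi) * matchingRate n := by ring
      _ ≤ _ := by gcongr; exact le_max_right _ _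

/-! ### Graphs compatible with a fixed partition, and partitions with given class sizes. -/

/-- The graphs all of whose induced subgraphs on the fibres of `p` are complements of matchings. -/
def coMatchingGraphs {V ι : Type*} (p : V → ι) : Set (SimpleGraph V) :=
  {G | ∀ i, IsCoMatching (G.induce {v | p v = i})}

/-- This form speaks of vertices of `V` only, which avoids subtypes when two partitions are
compared. -/
lemma mem_coMatchingGraphs {V ι : Type*} {p : V → ι} {G : SimpleGraph V} :
    G ∈ coMatchingGraphs p ↔ ∀ v a b, p a = p v → p b = p v → a ≠ v → b ≠ v →
      ¬ G.Adj v a → ¬ G.Adj v b → a = b := by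
  constructor
  · intro h v a b ha hb ha' hb' hva hvb
    have key := isMatchingGraph_iff.1 (h (p v))
    have := @key ⟨v, rfl⟩ ⟨a, ha⟩ ⟨b, hb⟩
    simpa [SimpleGraph.compl_adj, hva, hvb, ha'.symm, hb'.symm] using this
  · intro h i
    refine isMatchingGraph_iff.2 ?_
    rintro ⟨v, hv⟩ ⟨a, ha⟩ ⟨b, hb⟩ h1 h2
    have hv' : p v = i := hv
    have ha' : p a = i := ha
    have hb' : p b = i := hb
    simp only [SimpleGraph.compl_adj, ne_eq, Subtype.mk.injEq, SimpleGraph.comap_adj,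
      Function.Embedding.subtype_apply] at h1 h2
    exact Subtype.ext (h v a b (by rw [ha', hv']) (by rw [hb', hv']) (Ne.symm h1.1)
      (Ne.symm h2.1) h1.2 h2.2)

/-- The graph joining vertices in distinct fibres of `p`. -/
abbrev crossGraph {V ι : Type*} (p : V → ι) : SimpleGraph V := (⊤ : SimpleGraph ι).comap p

/-- A graph with co-matching fibres consists of a matching on each fibre and a set of cross
edges. -/
def coMatchingGraphsEquiv {V ι : Type*} (p : V → ι) :
    coMatchingGraphs p ≃
      (∀ i, {H : SimpleGraph {v // p v = i} // IsMatchingGraph H}) × Set (crossGraph p).edgeSet where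
  toFun G := (fun i => ⟨(G.1.induce {v | p v = i})ᶜ, G.2 i⟩, {e | e.1 ∈ G.1.edgeSet})
  invFun x := ⟨
    { Adj := fun a b => (a ≠ b ∧ ∃ i, ∃ (ha : p a = i) (hb : p b = i),
          ¬ (x.1 i).1.Adj ⟨a, ha⟩ ⟨b, hb⟩) ∨ s(a, b) ∈ Subtype.val '' x.2
      symm := ⟨by
        rintro a b (⟨hab, i, ha, hb, h⟩ | h)
        · exact Or.inl ⟨hab.symm, i, hb, ha, fun h' => h h'.symm⟩
        · exact Or.inr (by rwa [Sym2.eq_swap])⟩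
      loopless := ⟨by
        rintro a (⟨h, -⟩ | ⟨⟨e, he⟩, -, h⟩)
        · exact h rfl
        · obtain rfl : e = s(a, a) := h
          simp at he⟩ }, by
    intro i
    refine isMatchingGraph_iff.2 ?_
    have key := isMatchingGraph_iff.1 (x.1 i).2
    have hh : ∀ u v : {v | p v = i}, ¬ ((u.1 ≠ v.1 ∧ ∃ i, ∃ (ha : p u = i) (hb : p v = i),
          ¬ (x.1 i).1.Adj ⟨u, ha⟩ ⟨v, hb⟩) ∨ s(u.1, v.1) ∈ Subtype.val '' x.2) → u ≠ v →
          (x.1 i).1.Adj u v := by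
      intro u v h huv
      by_contra hc
      exact h (Or.inl ⟨fun e => huv (Subtype.ext e), i, u.2, v.2, hc⟩)
    intro v a b h1 h2
    rw [SimpleGraph.compl_adj] at h1 h2
    exact key (hh _ _ h1.2 h1.1) (hh _ _ h2.2 h2.1)⟩
  left_inv := by
    rintro ⟨G, hG⟩
    ext a b
    simp only [SimpleGraph.compl_adj, SimpleGraph.comap_adj, Function.Embedding.subtype_apply]
    constructor
    · rintro (⟨hab, i, ha, hb, h⟩ | ⟨e, he, h⟩)
      · by_contra hc
        exact h ⟨fun e => hab (congrArg Subtype.val e), hc⟩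
      · have he' : e.1 ∈ G.edgeSet := he
        rw [h] at he'
        exact he'
    · intro h
      by_cases hp : p a = p b
      · exact Or.inl ⟨h.ne, p b, hp, rfl, fun h' => h'.2 h⟩
      · exact Or.inr ⟨⟨s(a, b), hp⟩, h, rfl⟩
  right_inv := by
    rintro ⟨M, S⟩
    refine Prod.ext (funext fun i => Subtype.ext ?_) ?_
    · ext ⟨a, ha⟩ ⟨b, hb⟩
      simp only [SimpleGraph.compl_adj, SimpleGraph.comap_adj, Function.Embedding.subtype_apply]
      constructor
      · rintro ⟨hab, h⟩
        by_contra hc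
        exact h (Or.inl ⟨fun e => hab (Subtype.ext e), i, ha, hb, hc⟩)
      · intro h
        refine ⟨h.ne, ?_⟩
        rintro (⟨hab, j, ha', hb', h'⟩ | ⟨⟨e, he⟩, -, rfl⟩)
        · subst ha'
          obtain rfl : p a = i := ha
          exact h' h
        · have he : p a ≠ p b := he
          exact he (Eq.trans ha (Eq.symm hb))
    · ext ⟨e, he⟩
      induction e using Sym2.ind with
      | _ a b =>
        simp only [Set.mem_ofPred_eq, SimpleGraph.mem_edgeSet]
        constructor
        · rintro (⟨hab, i, ha, hb, h⟩ | ⟨e, he, h⟩)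
          · have he : p a ≠ p b := he
            exact absurd (ha.trans hb.symm) he
          · convert he
            exact h.symm
        · intro h
          exact Or.inr ⟨_, h, rfl⟩

section fiberCard
variable {V ι : Type*} [Fintype V] [Fintype ι] [DecidableEq ι]

/-- The size of the fibre of `p` over `i`. -/
def fiberCard (p : V → ι) (i : ι) : ℕ := (Finset.univ.filter fun v => p v = i).card

lemma sum_fiberCard (p : V → ι) : ∑ i, fiberCard p i = Fintype.card V :=
  (Finset.card_eq_sum_card_fiberwise (s := Finset.univ) (t := Finset.univ) (f := p)
    fun _ _ => Finset.mem_coe.2 (Finset.mem_univ _)).symm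

lemma card_coMatchingGraphs (p : V → ι) :
    (coMatchingGraphs p).ncard =
      (∏ i, matchingCount (fiberCard p i)) * 2 ^ (crossGraph p).edgeSet.ncard := by
  classical
  rw [← Nat.card_coe_set_eq, Nat.card_congr (coMatchingGraphsEquiv p), Nat.card_prod,
    Nat.card_pi]
  congr 1
  · refine Finset.prod_congr rfl fun i _ => ?_
    have := numMatchings_eq {v // p v = i}
    rw [numMatchings] at this
    rw [this, Nat.card_eq_fintype_card, Fintype.card_subtype]
    rfl
  · rw [Nat.card_eq_fintype_card, Fintype.card_set, ← Nat.card_eq_fintype_card,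
      Nat.card_coe_set_eq]

/-- A vertex has cross degree `|V|` minus the size of its own class; sum over the vertices. -/
lemma two_mul_card_crossGraph (p : V → ι) :
    2 * (crossGraph p).edgeSet.ncard + ∑ i, fiberCard p i ^ 2 = Fintype.card V ^ 2 := by
  classical
  have h1 := (crossGraph p).sum_degrees_eq_twice_card_edges
  have h2 : ∀ v, (crossGraph p).degree v + fiberCard p (p v) = Fintype.card V := by
    intro v
    rw [← SimpleGraph.card_neighborFinset_eq_degree, fiberCard, ← Finset.card_univ,
      ← Finset.card_filter_add_card_filter_not (s := Finset.univ) (fun u => p u = p v), add_comm]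
    congr 2
    ext u
    simp [eq_comm]
  have h3 : ∑ v, fiberCard p (p v) = ∑ i, fiberCard p i ^ 2 := by
    rw [← Finset.sum_fiberwise (s := Finset.univ) (g := p)]
    refine Finset.sum_congr rfl fun i _ => ?_
    rw [Finset.sum_congr rfl (g := fun _ => fiberCard p i)
      (fun v hv => by rw [(Finset.mem_filter.1 hv).2])]
    rw [Finset.sum_const, smul_eq_mul, sq]
    rfl
  rw [Set.ncard_eq_toFinset_card', ← h3]
  change 2 * (crossGraph p).edgeFinset.card + _ = _
  rw [← h1, ← Finset.sum_add_distrib, Finset.sum_congr rfl fun v _ => h2 v]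
  simp [sq]

/-- The number of maps with prescribed fibre sizes is a multinomial coefficient. -/
lemma card_fiberCard_eq_mul [DecidableEq V] (p₀ : V → ι) :
    (Finset.univ.filter fun p : V → ι => fiberCard p = fiberCard p₀).card *
      ∏ i, (fiberCard p₀ i).factorial = (Fintype.card V).factorial := by
  -- Permutations of `V` act by precomposition. The orbit of `p₀` consists of the maps with its
  -- fibre sizes, and each `{g | p₀ ∘ g = p}` is a coset of the stabilizer, whose order is `∏ k_i!`.
  have hmaps : ∀ g ∈ (Finset.univ : Finset (Equiv.Perm V)),
      p₀ ∘ g ∈ Finset.univ.filter fun p : V → ι => fiberCard p = fiberCard p₀ := by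
    intro g _
    simp only [Finset.mem_filter, Finset.mem_univ, true_and]
    funext i
    exact Finset.card_bij (fun v _ => g v) (by simp) (by simp)
      (fun b hb => ⟨g.symm b, by simpa using hb, by simp⟩)
  have hfib : ∀ p ∈ Finset.univ.filter fun p : V → ι => fiberCard p = fiberCard p₀,
      (Finset.univ.filter fun g : Equiv.Perm V => p₀ ∘ g = p).card =
        ∏ i, (fiberCard p₀ i).factorial := by
    intro p hp
    simp only [Finset.mem_filter, Finset.mem_univ, true_and] at hp
    have e : ∀ i, {v // p v = i} ≃ {v // p₀ v = i} := fun i => Fintype.equivOfCardEq (by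
      rw [Fintype.card_subtype, Fintype.card_subtype]
      exact congrFun hp i)
    obtain ⟨g₀, hg₀⟩ : ∃ g₀ : Equiv.Perm V, p₀ ∘ g₀ = p :=
      ⟨Equiv.ofFiberEquiv e, funext fun v => Equiv.ofFiberEquiv_map e v⟩
    have h := DomMulAct.stabilizer_card p₀
    rw [Fintype.card_subtype] at h
    refine Eq.trans ?_ (h.trans (Finset.prod_congr rfl fun i _ => by
      rw [Fintype.card_subtype]; rfl))
    refine Finset.card_bij (fun g _ => g * g₀⁻¹) ?_ (fun _ _ _ _ h => mul_right_cancel h) ?_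
    · intro g hg
      simp only [Finset.mem_filter, Finset.mem_univ, true_and] at hg ⊢
      rw [← hg₀] at hg
      funext v
      have := congrFun hg (g₀⁻¹ v)
      simpa using this
    · intro g hg
      simp only [Finset.mem_filter, Finset.mem_univ, true_and] at hg
      refine ⟨g * g₀, ?_, by simp⟩
      simp only [Finset.mem_filter, Finset.mem_univ, true_and]
      rw [← hg₀]
      funext v
      simpa using congrFun hg (g₀ v)
  rw [← Fintype.card_perm, ← Finset.card_univ, Finset.card_eq_sum_card_fiberwise hmaps,
    Finset.sum_congr rfl hfib, Finset.sum_const, smul_eq_mul]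

end fiberCard

/-! ### The weight of one class: matchings divided by a factorial. -/

/-- Stirling's formula as two-sided bounds valid for all `n`, with `√(n + 1)` in place of `√n`. -/
lemma factorial_bounds : ∃ c C : ℝ, 0 < c ∧ 0 < C ∧ ∀ n : ℕ,
    c * (Real.sqrt (n + 1) * Real.exp (n * Real.log n - n)) ≤ n.factorial ∧
      (n.factorial : ℝ) ≤ C * (Real.sqrt (n + 1) * Real.exp (n * Real.log n - n)) := by
  obtain ⟨b, hb0, hb⟩ := Stirling.stirlingSeq'_bounded_by_pos_constant
  have hexp : ∀ n : ℕ, 1 ≤ n → ((n : ℝ) / Real.exp 1) ^ n = Real.exp (n * Real.log n - n) := by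
    intro n hn
    have hn' : (0 : ℝ) < n := by exact_mod_cast hn
    rw [← Real.rpow_natCast, Real.rpow_def_of_pos (by positivity), Real.log_div hn'.ne'
      (Real.exp_ne_zero _), Real.log_exp]
    ring_nf
  have hsq : ∀ n : ℕ, 1 ≤ n → Real.sqrt (n + 1) ≤ Real.sqrt (2 * n) := fun n hn =>
    Real.sqrt_le_sqrt (by have : (1 : ℝ) ≤ n := by exact_mod_cast hn
                          linarith)
  have hsq2 : ∀ n : ℕ, Real.sqrt (2 * n) ≤ 2 * Real.sqrt (n + 1) := fun n => by
    rw [show (2 : ℝ) * Real.sqrt (n + 1) = Real.sqrt (4 * (n + 1)) by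
      rw [Real.sqrt_mul (by norm_num), show (4 : ℝ) = 2 ^ 2 by norm_num,
        Real.sqrt_sq (by norm_num)]]
    exact Real.sqrt_le_sqrt (by have : (0 : ℝ) ≤ n := by positivity
                                linarith)
  have hfac : ∀ n : ℕ, 1 ≤ n → (n.factorial : ℝ) =
      Stirling.stirlingSeq n * (Real.sqrt (2 * n) * Real.exp (n * Real.log n - n)) := by
    intro n hn
    have hn' : (0 : ℝ) < n := by exact_mod_cast hn
    rw [← hexp n hn, Stirling.stirlingSeq, div_mul_cancel₀]
    positivity
  set M := Stirling.stirlingSeq 1 with hM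
  have hM' : ∀ n : ℕ, 1 ≤ n → Stirling.stirlingSeq n ≤ M := fun n hn => by
    obtain ⟨k, rfl⟩ := Nat.exists_eq_add_of_le' hn
    exact Stirling.stirlingSeq'_antitone (Nat.zero_le k)
  have hb' : ∀ n : ℕ, 1 ≤ n → b ≤ Stirling.stirlingSeq n := fun n hn => by
    obtain ⟨k, rfl⟩ := Nat.exists_eq_add_of_le' hn
    exact hb k
  have hM0 : 0 < M := Stirling.stirlingSeq'_pos 0
  refine ⟨min 1 b, max 1 (M * 2), by positivity, by positivity, fun n => ?_⟩
  rcases Nat.eq_zero_or_pos n with rfl | hn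
  · simp
  have hs := Real.sqrt_nonneg ((n : ℝ) + 1)
  rw [hfac n hn]
  have e0 := Real.exp_pos (n * Real.log n - n)
  constructor
  · exact mul_le_mul ((min_le_right _ _).trans (hb' n hn))
      (mul_le_mul_of_nonneg_right (hsq n hn) e0.le) (by positivity) (hb0.le.trans (hb' n hn))
  · calc _ ≤ M * (2 * Real.sqrt (n + 1) * Real.exp (n * Real.log n - n)) := by
          gcongr
          exacts [hM' n hn, hsq2 n]
      _ = M * 2 * (Real.sqrt (n + 1) * Real.exp (n * Real.log n - n)) := by ring
      _ ≤ _ := by gcongr; exact le_max_right _ _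

/-- The exponent governing the number of matchings divided by a factorial. -/
noncomputable def classExponent (a : ℝ) : ℝ := -(a / 2) * Real.log a + a / 2 + Real.sqrt a

/-- The derivative of `classExponent`. -/
noncomputable def classSlope (a : ℝ) : ℝ := -(1 / 2) * Real.log a + 1 / (2 * Real.sqrt a)

/-- Concavity, checked separately for `-x log x` and `√x`. With `Real.log 0 = 0` it includes `k =
0`, as needed for empty classes. -/
lemma classExponent_le_tangent {a : ℝ} (ha : 0 < a) (k : ℕ) :
    classExponent k ≤ classExponent a + classSlope a * (k - a) := by
  have h1 : (k : ℝ) * Real.log a + (k - a) ≤ k * Real.log k := by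
    rcases Nat.eq_zero_or_pos k with rfl | hk
    · simp [ha.le]
    have hk' : (0 : ℝ) < k := by exact_mod_cast hk
    have := Real.log_le_sub_one_of_pos (div_pos ha hk')
    rw [Real.log_div ha.ne' hk'.ne'] at this
    have h := mul_le_mul_of_nonneg_left this hk'.le
    have e : (k : ℝ) * (a / k - 1) = a - k := by field_simp
    rw [e] at h
    linarith
  have h2 : Real.sqrt k ≤ Real.sqrt a + 1 / (2 * Real.sqrt a) * (k - a) := by
    have hs := Real.sqrt_pos.2 ha
    have e : Real.sqrt a + 1 / (2 * Real.sqrt a) * (k - a) = (a + k) / (2 * Real.sqrt a) := by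
      field_simp
      nlinarith [Real.sq_sqrt ha.le]
    rw [e, le_div_iff₀ (by positivity)]
    nlinarith [Real.sq_sqrt ha.le, Real.sq_sqrt (Nat.cast_nonneg (α := ℝ) k),
      sq_nonneg (Real.sqrt k - Real.sqrt a)]
  unfold classExponent classSlope
  nlinarith

/-- At distance at most one from `a`, the entropy term loses at most `1/2`, the square root at most
`1`, and its linear part at most `1/2`. -/
lemma tangent_le_classExponent {a : ℝ} (ha : 1 ≤ a) {k : ℕ} (hk : |(k : ℝ) - a| ≤ 1) :
    classExponent a + classSlope a * (k - a) - 2 ≤ classExponent k := by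
  have ha0 : 0 < a := by linarith
  obtain ⟨hk1, hk2⟩ := abs_le.1 hk
  have hd : ((k : ℝ) - a) ^ 2 ≤ 1 := by nlinarith
  have h1 : (k : ℝ) * Real.log k ≤ k * Real.log a + (k - a) + 1 := by
    rcases Nat.eq_zero_or_pos k with rfl | hk
    · simp at *; linarith
    have hk' : (0 : ℝ) < k := by exact_mod_cast hk
    have := Real.log_le_sub_one_of_pos (div_pos hk' ha0)
    rw [Real.log_div hk'.ne' ha0.ne'] at this
    have h := mul_le_mul_of_nonneg_left this hk'.le
    have e : (k : ℝ) * (k / a - 1) = (k - a) + (k - a) ^ 2 / a := by field_simp; ring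
    have e2 : ((k : ℝ) - a) ^ 2 / a ≤ 1 := by rw [div_le_one ha0]; linarith
    rw [e] at h
    linarith
  have hs : 1 ≤ Real.sqrt a := Real.one_le_sqrt.2 ha
  have h2 : Real.sqrt a - 1 ≤ Real.sqrt k := by
    refine Real.le_sqrt_of_sq_le ?_
    nlinarith [Real.sq_sqrt ha0.le]
  have h3 : 1 / (2 * Real.sqrt a) * (k - a) ≤ 1 / 2 := by
    rw [div_mul_eq_mul_div, div_le_div_iff₀ (by positivity) (by norm_num)]
    nlinarith
  unfold classExponent classSlope
  nlinarith

lemma matchingCount_div_factorial_bounds : ∃ c C : ℝ, 0 < c ∧ 0 < C ∧ ∀ n : ℕ,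
    c * (Real.exp (classExponent n) / Real.sqrt (n + 1)) ≤ matchingCount n / n.factorial ∧
      (matchingCount n : ℝ) / n.factorial ≤
        C * (Real.exp (classExponent n) / Real.sqrt (n + 1)) := by
  obtain ⟨c₁, C₁, hc₁, hC₁, h₁⟩ := matchingCount_bounds
  obtain ⟨c₂, C₂, hc₂, hC₂, h₂⟩ := factorial_bounds
  refine ⟨c₁ / C₂, C₁ / c₂, by positivity, by positivity, fun n => ?_⟩
  have e : Real.exp (classExponent n) / Real.sqrt (n + 1) = matchingRate n /
      (Real.sqrt (n + 1) * Real.exp (n * Real.log n - n)) := by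
    rw [matchingRate, mul_comm (Real.sqrt _), ← div_div, ← Real.exp_sub, classExponent]
    ring_nf
  have hf : (0 : ℝ) < n.factorial := by positivity
  have hr := matchingRate_pos n
  rw [e, div_mul_div_comm, div_mul_div_comm]
  constructor
  · have := (mul_pos hc₁ hr).le.trans (h₁ n).1
    exact div_le_div₀ this (h₁ n).1 hf (h₂ n).2
  · exact div_le_div₀ (by positivity) (h₁ n).2 (by positivity) (h₂ n).1

/-- Replacing `√(k + 1)` by `√a` costs a factor `√(1 + |k - a|)`, because `a ≤ (k + 1)(1 + |k -
a|)`. The Gaussian weight will absorb it. -/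
lemma matchingCount_div_factorial_le : ∃ C : ℝ, 0 < C ∧ ∀ (a : ℝ) (k : ℕ), 0 < a →
    (matchingCount k : ℝ) / k.factorial ≤ C * (Real.exp (classExponent a) / Real.sqrt a) *
      (Real.sqrt (1 + |(k : ℝ) - a|) * Real.exp (classSlope a * (k - a))) := by
  obtain ⟨_, C, _, hC, h⟩ := matchingCount_div_factorial_bounds
  refine ⟨C, hC, fun a k ha => (h k).2.trans ?_⟩
  rw [mul_assoc]
  refine mul_le_mul_of_nonneg_left ?_ hC.le
  have hs : Real.sqrt a ≤ Real.sqrt (k + 1) * Real.sqrt (1 + |(k : ℝ) - a|) := by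
    rw [← Real.sqrt_mul (by positivity)]
    refine Real.sqrt_le_sqrt ?_
    nlinarith [neg_abs_le ((k : ℝ) - a), abs_nonneg ((k : ℝ) - a),
      mul_nonneg (Nat.cast_nonneg (α := ℝ) k) (abs_nonneg ((k : ℝ) - a))]
  have ha' := Real.sqrt_pos.2 ha
  calc Real.exp (classExponent k) / Real.sqrt (k + 1)
      ≤ Real.exp (classExponent a + classSlope a * (k - a)) *
          (Real.sqrt (1 + |(k : ℝ) - a|) / Real.sqrt a) := by
        rw [div_eq_mul_inv]
        refine mul_le_mul (Real.exp_le_exp.2 (classExponent_le_tangent ha k)) ?_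
          (by positivity) (by positivity)
        rw [inv_eq_one_div, div_le_div_iff₀ (by positivity) ha']
        linarith
    _ = _ := by rw [Real.exp_add]; ring

lemma le_matchingCount_div_factorial : ∃ c : ℝ, 0 < c ∧ ∀ (a : ℝ) (k : ℕ), 1 ≤ a →
    |(k : ℝ) - a| ≤ 1 → c * (Real.exp (classExponent a) / Real.sqrt a) *
      Real.exp (classSlope a * (k - a)) ≤ (matchingCount k : ℝ) / k.factorial := by
  obtain ⟨c, _, hc, _, h⟩ := matchingCount_div_factorial_bounds
  refine ⟨c * (Real.exp (-2) / 2), by positivity, fun a k ha hk => le_trans ?_ (h k).1⟩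
  rw [mul_assoc, mul_assoc]
  refine mul_le_mul_of_nonneg_left ?_ hc.le
  have ha' := Real.sqrt_pos.2 (zero_lt_one.trans_le ha)
  have hs : Real.sqrt (k + 1) ≤ 2 * Real.sqrt a := by
    rw [show (2 : ℝ) * Real.sqrt a = Real.sqrt (4 * a) by
      rw [Real.sqrt_mul (by norm_num), show (4 : ℝ) = 2 ^ 2 by norm_num,
        Real.sqrt_sq (by norm_num)]]
    refine Real.sqrt_le_sqrt ?_
    linarith [(abs_le.1 hk).2]
  calc _ = Real.exp (classExponent a + classSlope a * (k - a) - 2) / (2 * Real.sqrt a) := by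
        rw [Real.exp_sub, Real.exp_add, Real.exp_neg]
        field_simp
    _ ≤ _ := div_le_div₀ (by positivity) (Real.exp_le_exp.2 (tangent_le_classExponent ha hk))
        (by positivity) hs

/-- The bound must not depend on the centre `a`, so the terms are compared with a geometric series
in `|k - ⌊a⌋|`. -/
lemma sum_gaussian_weight_le : ∃ B : ℝ, 0 < B ∧ ∀ (a : ℝ) (n : ℕ), 
    ∑ k ∈ Finset.range n, Real.sqrt (1 + |(k : ℝ) - a|) * (2 : ℝ) ^ (-((k : ℝ) - a) ^ 2 / 2) ≤
      B := by
  have hsum : Summable fun z : ℤ => (1 / 2 : ℝ) ^ z.natAbs :=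
    Summable.of_nat_of_neg (by simpa using summable_geometric_two)
      (by simpa using summable_geometric_two)
  refine ⟨8 * ∑' z : ℤ, (1 / 2 : ℝ) ^ z.natAbs + 1, ?_, fun a n => ?_⟩
  · have : (0 : ℝ) ≤ ∑' z : ℤ, (1 / 2 : ℝ) ^ z.natAbs := tsum_nonneg fun _ => by positivity
    positivity
  have hterm : ∀ k : ℕ, Real.sqrt (1 + |(k : ℝ) - a|) * (2 : ℝ) ^ (-((k : ℝ) - a) ^ 2 / 2) ≤
      8 * (1 / 2 : ℝ) ^ ((k : ℤ) - ⌊a⌋).natAbs := by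
    intro k
    set x := |(k : ℝ) - a| with hx
    have hx0 : 0 ≤ x := abs_nonneg _
    have h1 : Real.sqrt (1 + x) ≤ (2 : ℝ) ^ x := by
      rw [Real.sqrt_le_left (by positivity), Real.rpow_def_of_pos (by norm_num), ← Real.exp_nat_mul]
      have := Real.add_one_le_exp ((2 : ℕ) * (Real.log 2 * x))
      have := Real.log_two_gt_d9
      push_cast at *
      nlinarith
    have h2 : -((k : ℝ) - a) ^ 2 / 2 = - x ^ 2 / 2 := by rw [hx, sq_abs]
    have h3 : (((k : ℤ) - ⌊a⌋).natAbs : ℝ) ≤ x + 1 := by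
      rw [Nat.cast_natAbs]
      push_cast
      have := Int.floor_le a
      have := Int.lt_floor_add_one a
      rw [hx, abs_le]
      constructor <;> linarith [neg_abs_le ((k : ℝ) - a), le_abs_self ((k : ℝ) - a)]
    calc _ ≤ (2 : ℝ) ^ x * (2 : ℝ) ^ (-x ^ 2 / 2) := by rw [h2]; gcongr
      _ = (2 : ℝ) ^ (x + -x ^ 2 / 2) := (Real.rpow_add (by norm_num) _ _).symm
      -- Since `|k - ⌊a⌋| ≤ x + 1`, it is enough that `2x - x²/2 ≤ 2`, which is `(x - 2)² ≥ 0`. The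
      -- `3` gives the constant `8`.
      _ ≤ (2 : ℝ) ^ (3 + -(((k : ℤ) - ⌊a⌋).natAbs : ℝ)) := by
        refine Real.rpow_le_rpow_of_exponent_le (by norm_num) ?_
        nlinarith [sq_nonneg (x - 2)]
      _ = _ := by
        rw [Real.rpow_add (by norm_num), Real.rpow_neg (by norm_num), Real.rpow_natCast,
          one_div, inv_pow]
        norm_num
  have hinj : Set.InjOn (fun k : ℕ => (k : ℤ) - ⌊a⌋) (Finset.range n) := fun x _ y _ h => by
    simpa using h
  calc _ ≤ ∑ k ∈ Finset.range n, 8 * (1 / 2 : ℝ) ^ ((k : ℤ) - ⌊a⌋).natAbs :=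
        Finset.sum_le_sum fun k _ => hterm k
    _ = 8 * ∑ z ∈ (Finset.range n).image (fun k : ℕ => (k : ℤ) - ⌊a⌋), (1 / 2 : ℝ) ^ z.natAbs := by
        rw [← Finset.mul_sum, Finset.sum_image hinj]
    _ ≤ 8 * ∑' z : ℤ, (1 / 2 : ℝ) ^ z.natAbs := by
        gcongr
        exact hsum.sum_le_tsum _ fun _ _ => by positivity
    _ ≤ _ := by linarith

/-! ### The upper bound. -/

/-- The order of magnitude of the number of graphs, before applying Stirling's formula. -/
noncomputable def unsimplifiedRate (w n : ℕ) : ℝ :=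
  n.factorial * (2 : ℝ) ^ ((1 - 1 / (w : ℝ)) * ((n : ℝ) ^ 2 / 2)) *
    (Real.exp (classExponent (n / w)) / Real.sqrt (n / w)) ^ w

/-- As the sizes have mean `n / w`, `∑ k_i² = n²/w + ∑ (k_i - n/w)²`; so the number of cross edges
splits into its maximal value and a Gaussian penalty for each class. -/
lemma cast_ncard_coMatchingGraphs {w n : ℕ} (hw : 1 ≤ w) (p : Fin n → Fin w) :
    ((coMatchingGraphs p).ncard : ℝ) = (2 : ℝ) ^ ((1 - 1 / (w : ℝ)) * ((n : ℝ) ^ 2 / 2)) *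
      ∏ i, ((matchingCount (fiberCard p i) : ℝ) *
        (2 : ℝ) ^ (-((fiberCard p i : ℝ) - n / w) ^ 2 / 2)) := by
  have hw' : (0 : ℝ) < w := by exact_mod_cast hw
  have h1 : (2 : ℝ) * (crossGraph p).edgeSet.ncard + ∑ i, (fiberCard p i : ℝ) ^ 2 = n ^ 2 := by
    have := two_mul_card_crossGraph p
    rw [Fintype.card_fin] at this
    exact_mod_cast this
  have h2 : ∑ i, (fiberCard p i : ℝ) = n := by
    have := sum_fiberCard p
    rw [Fintype.card_fin] at this
    exact_mod_cast this
  have h3 : ∑ i, ((fiberCard p i : ℝ) - n / w) ^ 2 =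
      ∑ i, (fiberCard p i : ℝ) ^ 2 - (n : ℝ) ^ 2 / w := by
    simp only [sub_sq, Finset.sum_add_distrib, Finset.sum_sub_distrib, ← Finset.sum_mul,
      ← Finset.mul_sum, h2, Finset.sum_const, Finset.card_univ, Fintype.card_fin, nsmul_eq_mul]
    field_simp
    ring
  rw [card_coMatchingGraphs]
  push_cast
  rw [Finset.prod_mul_distrib, ← Real.rpow_sum_of_pos (by norm_num : (0 : ℝ) < 2), mul_left_comm,
    ← Real.rpow_add (by norm_num), ← Real.rpow_natCast]
  congr 2
  rw [← Finset.sum_div, Finset.sum_neg_distrib, h3]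
  field_simp
  linear_combination (w : ℝ) * h1

lemma coMatchingPartitionableCount_le_sum (w n : ℕ) :
    (coMatchingPartitionableCount w n : ℝ) ≤
      ∑ p : Fin n → Fin w, ((coMatchingGraphs p).ncard : ℝ) := by
  have : {G : SimpleGraph (Fin n) | CoMatchingPartitionable w G} =
      ⋃ p ∈ (Finset.univ : Finset (Fin n → Fin w)), coMatchingGraphs p := by
    ext G
    simp [CoMatchingPartitionable, coMatchingGraphs]
  rw [coMatchingPartitionableCount, this]
  exact_mod_cast Finset.set_ncard_biUnion_le _ _

/-- This is the cancellation of the tangent's linear terms in the product over classes. -/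
lemma sum_classSlope {w n : ℕ} (hw : 1 ≤ w) (p : Fin n → Fin w) (s : ℝ) :
    ∑ i, s * ((fiberCard p i : ℝ) - n / w) = 0 := by
  have hw' : (0 : ℝ) < w := by exact_mod_cast hw
  have h2 : ∑ i, (fiberCard p i : ℝ) = n := by
    have := sum_fiberCard p
    rw [Fintype.card_fin] at this
    exact_mod_cast this
  rw [← Finset.mul_sum, Finset.sum_sub_distrib, h2]
  simp
  field_simp
  simp

lemma coMatchingPartitionableCount_le (w : ℕ) (hw : 1 ≤ w) : ∃ C : ℝ, 0 < C ∧ ∀ n : ℕ, 1 ≤ n →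
    (coMatchingPartitionableCount w n : ℝ) ≤ C * unsimplifiedRate w n := by
  obtain ⟨C, hC, h⟩ := matchingCount_div_factorial_le
  obtain ⟨B, hB, hsum⟩ := sum_gaussian_weight_le
  have hw' : (0 : ℝ) < w := by exact_mod_cast hw
  refine ⟨C ^ w * B ^ w, by positivity, fun n hn => ?_⟩
  have hn' : (0 : ℝ) < n := by exact_mod_cast hn
  refine (coMatchingPartitionableCount_le_sum w n).trans ?_
  set a : ℝ := n / w with ha
  have ha0 : 0 < a := by positivity
  set Q : ℝ := (2 : ℝ) ^ ((1 - 1 / (w : ℝ)) * ((n : ℝ) ^ 2 / 2)) with hQ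
  have hQ0 : 0 < Q := by positivity
  set R : ℝ := Real.exp (classExponent a) / Real.sqrt a with hR
  have hR0 : 0 < R := by positivity
  let φ : ℕ → ℝ := fun k => (2 : ℝ) ^ (-((k : ℝ) - a) ^ 2 / 2)
  let ψ : ℕ → ℝ := fun k => Real.sqrt (1 + |(k : ℝ) - a|) * φ k
  -- The contribution of one size vector: the multinomial coefficient supplies `n!` and the factors
  -- `1 / k_i!`, and the tangent terms multiply to one.
  have hclass : ∀ p₀ : Fin n → Fin w,
      ∑ p ∈ Finset.univ.filter (fun p : Fin n → Fin w => fiberCard p = fiberCard p₀),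
        ((coMatchingGraphs p).ncard : ℝ) ≤
        n.factorial * Q * (C * R) ^ w * ∏ i, ψ (fiberCard p₀ i) := by
    intro p₀
    have e1 : ∀ p ∈ Finset.univ.filter (fun p : Fin n → Fin w => fiberCard p = fiberCard p₀),
        ((coMatchingGraphs p).ncard : ℝ) =
          Q * ∏ i, ((matchingCount (fiberCard p₀ i) : ℝ) * φ (fiberCard p₀ i)) := by
      intro p hp
      rw [cast_ncard_coMatchingGraphs hw, (Finset.mem_filter.1 hp).2]
    have e2 : ((Finset.univ.filter (fun p : Fin n → Fin w => fiberCard p = fiberCard p₀)).card : ℝ)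
        * ∏ i, ((fiberCard p₀ i).factorial : ℝ) = n.factorial := by
      have := card_fiberCard_eq_mul p₀
      rw [Fintype.card_fin] at this
      exact_mod_cast this
    rw [Finset.sum_congr rfl e1, Finset.sum_const, nsmul_eq_mul, ← e2]
    set N : ℝ := ((Finset.univ.filter
      (fun p : Fin n → Fin w => fiberCard p = fiberCard p₀)).card : ℝ) with hN
    have hN0 : 0 ≤ N := by positivity
    calc N * (Q * ∏ i, ((matchingCount (fiberCard p₀ i) : ℝ) * φ (fiberCard p₀ i)))
        = N * Q * (∏ i, ((fiberCard p₀ i).factorial : ℝ)) *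
          ∏ i, ((matchingCount (fiberCard p₀ i) : ℝ) / (fiberCard p₀ i).factorial *
            φ (fiberCard p₀ i)) := by
          rw [mul_assoc (N * Q), ← Finset.prod_mul_distrib, mul_assoc]
          congr 2
          refine Finset.prod_congr rfl fun i _ => ?_
          field_simp
      _ ≤ N * Q * (∏ i, ((fiberCard p₀ i).factorial : ℝ)) *
          ∏ i, (C * R * (Real.exp (classSlope a * (fiberCard p₀ i - a)) * ψ (fiberCard p₀ i))) := by
          refine mul_le_mul_of_nonneg_left (Finset.prod_le_prod (fun i _ => by positivity)
            fun i _ => ?_) (by positivity)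
          have := mul_le_mul_of_nonneg_right (h a (fiberCard p₀ i) ha0)
            (show 0 ≤ φ (fiberCard p₀ i) by positivity)
          refine this.trans (le_of_eq ?_)
          simp only [ψ]
          ring
      _ = _ := by
          rw [Finset.prod_mul_distrib, Finset.prod_const, Finset.prod_mul_distrib, ← Real.exp_sum,
            sum_classSlope hw p₀]
          simp
          ring
  have hmaps : ∀ p ∈ (Finset.univ : Finset (Fin n → Fin w)),
      fiberCard p ∈ (Finset.univ : Finset (Fin n → Fin w)).image fiberCard :=
    fun p hp => Finset.mem_image_of_mem _ hp
  rw [← Finset.sum_fiberwise_of_maps_to hmaps]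
  calc _ ≤ ∑ k ∈ (Finset.univ : Finset (Fin n → Fin w)).image fiberCard,
        n.factorial * Q * (C * R) ^ w * ∏ i, ψ (k i) := by
        refine Finset.sum_le_sum fun k hk => ?_
        obtain ⟨p₀, -, rfl⟩ := Finset.mem_image.1 hk
        exact hclass p₀
    -- Dropping the constraint `∑ k_i = n` makes the sum factor into a `w`-th power.
    _ ≤ ∑ k ∈ Fintype.piFinset fun _ : Fin w => Finset.range (n + 1),
        n.factorial * Q * (C * R) ^ w * ∏ i, ψ (k i) := by
        refine Finset.sum_le_sum_of_subset_of_nonneg ?_ fun k _ _ => by positivity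
        intro k hk
        obtain ⟨p₀, -, rfl⟩ := Finset.mem_image.1 hk
        rw [Fintype.mem_piFinset]
        intro i
        rw [Finset.mem_range, Nat.lt_succ_iff]
        exact (Finset.card_le_univ _).trans (by simp)
    _ = n.factorial * Q * (C * R) ^ w * (∑ k ∈ Finset.range (n + 1), ψ k) ^ w := by
        rw [← Finset.mul_sum, Finset.sum_prod_piFinset]
        simp
    _ ≤ n.factorial * Q * (C * R) ^ w * B ^ w := by
        gcongr
        exact hsum a (n + 1)
    _ = _ := by
        rw [unsimplifiedRate, ← ha, ← hR, ← hQ]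
        ring

/-! ### The closed form of the rate. -/

lemma unsimplifiedRate_isTheta (w : ℕ) (hw : 1 ≤ w) :
    unsimplifiedRate w =Θ[atTop]
      (fun n : ℕ =>
        (w : ℝ) ^ n / (n : ℝ) ^ (((w : ℝ) - 1) / 2)
          * ((n : ℝ) / (Real.exp 1 * (w : ℝ))) ^ ((n : ℝ) / 2)
          * Real.exp (Real.sqrt ((n : ℝ) * (w : ℝ)))
          * (2 : ℝ) ^ ((1 - 1 / (w : ℝ)) * ((n : ℝ) ^ 2 / 2))) := by
  have hw' : (0 : ℝ) < w := by exact_mod_cast hw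
  obtain ⟨c, C, hc, hC, hf⟩ := factorial_bounds
  set T : ℕ → ℝ := fun n : ℕ =>
        (w : ℝ) ^ n / (n : ℝ) ^ (((w : ℝ) - 1) / 2)
          * ((n : ℝ) / (Real.exp 1 * (w : ℝ))) ^ ((n : ℝ) / 2)
          * Real.exp (Real.sqrt ((n : ℝ) * (w : ℝ)))
          * (2 : ℝ) ^ ((1 - 1 / (w : ℝ)) * ((n : ℝ) ^ 2 / 2)) with hT
  set K : ℝ := Real.exp (w / 2 * Real.log w) with hK
  have hK0 : 0 < K := Real.exp_pos _
  -- up to constants, the factorial is the only difference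
  have key : ∀ n : ℕ, 1 ≤ n → (Real.sqrt n * Real.exp (n * Real.log n - n)) *
      ((2 : ℝ) ^ ((1 - 1 / (w : ℝ)) * ((n : ℝ) ^ 2 / 2)) *
        (Real.exp (classExponent (n / w)) / Real.sqrt (n / w)) ^ w) = K * T n := by
    intro n hn
    have hn' : (0 : ℝ) < n := by exact_mod_cast hn
    have hs : ∀ x : ℝ, 0 < x → Real.sqrt x = Real.exp (1 / 2 * Real.log x) := fun x hx => by
      rw [Real.sqrt_eq_rpow, Real.rpow_def_of_pos hx, mul_comm]
    have hsqrt : (w : ℝ) * Real.sqrt (n / w) = Real.sqrt (n * w) := by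
      rw [show (n : ℝ) * w = w ^ 2 * (n / w) by field_simp, Real.sqrt_mul (by positivity),
        Real.sqrt_sq hw'.le]
    have e1 : (Real.exp (classExponent (n / w)) / Real.sqrt (n / w)) ^ w =
        Real.exp (w * (classExponent (n / w) - 1 / 2 * (Real.log n - Real.log w))) := by
      rw [hs _ (by positivity), Real.log_div hn'.ne' hw'.ne', ← Real.exp_sub, ← Real.exp_nat_mul]
    have e2 : (w : ℝ) ^ n = Real.exp (n * Real.log w) := by
      rw [← Real.rpow_natCast, Real.rpow_def_of_pos hw', mul_comm]
    simp only [hT]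
    rw [e1, e2, hs _ hn', Real.rpow_def_of_pos hn', Real.rpow_def_of_pos (by positivity :
      (0 : ℝ) < (n : ℝ) / (Real.exp 1 * w)), Real.log_div hn'.ne' (by positivity),
      Real.log_mul (by positivity) hw'.ne', Real.log_exp, ← Real.exp_add, ← Real.exp_sub,
      ← Real.exp_add, ← Real.exp_add, ← mul_assoc, mul_right_comm, ← Real.exp_add, ← mul_assoc,
      hK, ← Real.exp_add, ← hsqrt, classExponent, Real.log_div hn'.ne' hw'.ne']
    congr 2
    field_simp
    ring
  have hTpos : ∀ n : ℕ, 1 ≤ n → 0 < T n := fun n hn => by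
    have hn' : (0 : ℝ) < n := by exact_mod_cast hn
    simp only [hT]
    positivity
  have hle : ∀ n : ℕ, 1 ≤ n → Real.sqrt n ≤ Real.sqrt (n + 1) ∧
      Real.sqrt (n + 1) ≤ 2 * Real.sqrt n := fun n hn => by
    have hn' : (1 : ℝ) ≤ n := by exact_mod_cast hn
    refine ⟨Real.sqrt_le_sqrt (by linarith), ?_⟩
    rw [show (2 : ℝ) * Real.sqrt n = Real.sqrt (4 * n) by
      rw [Real.sqrt_mul (by norm_num), show (4 : ℝ) = 2 ^ 2 by norm_num,
        Real.sqrt_sq (by norm_num)]]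
    exact Real.sqrt_le_sqrt (by linarith)
  have hpos : ∀ n, 0 ≤ unsimplifiedRate w n := fun n => by unfold unsimplifiedRate; positivity
  constructor
  · refine IsBigO.of_bound (C * 2 * K) ?_
    filter_upwards [eventually_ge_atTop 1] with n hn
    rw [Real.norm_of_nonneg (hpos n), Real.norm_of_nonneg (hTpos n hn).le, mul_assoc, ← key n hn,
      unsimplifiedRate, mul_assoc (n.factorial : ℝ), ← mul_assoc (C * 2)]
    refine mul_le_mul_of_nonneg_right ((hf n).2.trans ?_) (by positivity)
    rw [mul_assoc C, ← mul_assoc 2]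
    gcongr
    exact (hle n hn).2
  · refine IsBigO.of_bound ((c * K)⁻¹) ?_
    filter_upwards [eventually_ge_atTop 1] with n hn
    rw [Real.norm_of_nonneg (hpos n), Real.norm_of_nonneg (hTpos n hn).le,
      ← div_eq_inv_mul, le_div_iff₀' (by positivity), mul_assoc, ← key n hn,
      unsimplifiedRate, mul_assoc (n.factorial : ℝ), ← mul_assoc c]
    refine mul_le_mul_of_nonneg_right (le_trans ?_ (hf n).1) (by positivity)
    gcongr
    linarith

/-! ### Rigid graphs and uniqueness of the partition. -/

lemma coMatchingGraphs_congr {V ι : Type*} {p : V → ι} {G H : SimpleGraph V}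
    (h : ∀ a b, p a = p b → (G.Adj a b ↔ H.Adj a b)) (hG : G ∈ coMatchingGraphs p) :
    H ∈ coMatchingGraphs p := by
  rw [mem_coMatchingGraphs] at *
  intro v a b ha hb ha' hb' hva hvb
  exact hG v a b ha hb ha' hb' (by rwa [h _ _ ha.symm]) (by rwa [h _ _ hb.symm])

/-- Replace the edges between `S` and `B` by those prescribed by `T`. -/
def replaceBetween {V : Type*} (G : SimpleGraph V) (S B : Finset V) (T : S → B.powerset) :
    SimpleGraph V where
  Adj x y := x ≠ y ∧ ((∃ h : x ∈ S, y ∈ (T ⟨x, h⟩).1) ∨ (∃ h : y ∈ S, x ∈ (T ⟨y, h⟩).1) ∨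
    (¬ (x ∈ S ∧ y ∈ B) ∧ ¬ (y ∈ S ∧ x ∈ B) ∧ G.Adj x y))
  symm := ⟨by
    rintro x y ⟨hxy, h | h | ⟨h1, h2, h3⟩⟩
    exacts [⟨hxy.symm, Or.inr (Or.inl h)⟩, ⟨hxy.symm, Or.inl h⟩,
      ⟨hxy.symm, Or.inr (Or.inr ⟨h2, h1, h3.symm⟩)⟩]⟩
  loopless := ⟨fun _ h => h.1 rfl⟩

section replaceBetween
variable {V : Type*} {G : SimpleGraph V} {S B : Finset V} {T : S → B.powerset}

lemma replaceBetween_adj_of_mem (hd : Disjoint S B) {x y : V} (hx : x ∈ S) (hy : y ∈ B) :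
    (replaceBetween G S B T).Adj x y ↔ y ∈ (T ⟨x, hx⟩).1 := by
  have hy' : y ∉ S := fun h => Finset.disjoint_left.1 hd h hy
  have hxy : x ≠ y := fun h => hy' (h ▸ hx)
  simp [replaceBetween, hx, hy, hy', hxy]

lemma replaceBetween_adj_of_not {x y : V} (h1 : ¬ (x ∈ S ∧ y ∈ B)) (h2 : ¬ (y ∈ S ∧ x ∈ B)) :
    (replaceBetween G S B T).Adj x y ↔ G.Adj x y := by
  constructor
  · rintro ⟨-, ⟨h, h'⟩ | ⟨h, h'⟩ | ⟨-, -, h⟩⟩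
    · exact absurd ⟨h, Finset.mem_powerset.1 (T ⟨x, h⟩).2 h'⟩ h1
    · exact absurd ⟨h, Finset.mem_powerset.1 (T ⟨y, h⟩).2 h'⟩ h2
    · exact h
  · intro h
    exact ⟨h.ne, Or.inr (Or.inr ⟨h1, h2, h⟩)⟩

end replaceBetween

/-- Each `|B|.choose i` with `i ≤ m` is at most the term `|B| ^ i * m.choose i` of the binomial
expansion. -/
lemma card_powerset_filter_card_le {V : Type*} (B : Finset V) (m : ℕ) :
    (B.powerset.filter fun T => T.card ≤ m).card ≤ (B.card + 1) ^ m := by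
  classical
  have hsub : B.powerset.filter (fun T => T.card ≤ m) ⊆
      (Finset.range (m + 1)).biUnion fun i => B.powersetCard i := by
    intro T hT
    rw [Finset.mem_filter, Finset.mem_powerset] at hT
    simp only [Finset.mem_biUnion, Finset.mem_range, Finset.mem_powersetCard]
    exact ⟨T.card, by omega, hT.1, rfl⟩
  refine (Finset.card_le_card hsub).trans (Finset.card_biUnion_le.trans ?_)
  rw [add_pow]
  refine Finset.sum_le_sum fun i hi => ?_
  rw [Finset.card_powersetCard, one_pow, mul_one]
  have : 0 < m.choose i := Nat.choose_pos (by simpa [Nat.lt_succ_iff] using hi)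
  exact (Nat.choose_le_pow _ _).trans (Nat.le_mul_of_pos_right _ this)

open Classical in
/-- The graphs with co-matching fibres in which every vertex of `S` has at most `m` non-neighbours
in `B`. -/
def sparseComplementGraphs {V ι : Type*} (p : V → ι) (S B : Finset V) (m : ℕ) :
    Set (SimpleGraph V) :=
  {G | G ∈ coMatchingGraphs p ∧ ∀ v ∈ S, (B.filter fun u => ¬ G.Adj v u).card ≤ m}

/-- Few graphs have few non-edges between two vertex sets lying in distinct fibres. -/
lemma card_sparseComplementGraphs_mul_le {V ι : Type*} [Finite V] (p : V → ι) (S B : Finset V)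
    (m : ℕ) (hSB : ∀ s ∈ S, ∀ b ∈ B, p s ≠ p b) :
    (sparseComplementGraphs p S B m).ncard * 2 ^ (S.card * B.card) ≤
      (coMatchingGraphs p).ncard * ((B.card + 1) ^ m) ^ S.card := by
  classical
  have := Fintype.ofFinite V
  have hd : Disjoint S B := Finset.disjoint_left.2 fun x hx hx' => hSB x hx x hx' rfl
  let D := B.powerset.filter fun T => T.card ≤ m
  -- Overwrite the `S`–`B` edges of `G` by an arbitrary choice `T` and record the lost non-neighbour
  -- sets, which are small. The new graph reveals `T`, the record restores `G`; since only cross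
  -- edges change, the classes stay co-matchings.
  let f : sparseComplementGraphs p S B m × (S → B.powerset) → coMatchingGraphs p × (S → D) :=
    fun x => (⟨replaceBetween x.1.1 S B x.2, coMatchingGraphs_congr (fun a b hab =>
        (replaceBetween_adj_of_not (fun h => hSB a h.1 b h.2 hab)
          (fun h => hSB b h.1 a h.2 hab.symm)).symm) x.1.2.1⟩,
      fun v => ⟨B.filter fun u => ¬ x.1.1.Adj v u, Finset.mem_filter.2
        ⟨Finset.mem_powerset.2 (Finset.filter_subset _ _), x.1.2.2 v v.2⟩⟩)
  have hf : Function.Injective f := by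
    rintro ⟨⟨G, hG⟩, T⟩ ⟨⟨H, hH⟩, U⟩ h
    simp only [f, Prod.mk.injEq, Subtype.mk.injEq] at h
    obtain ⟨h1, h2⟩ := h
    have hadj : ∀ x ∈ S, ∀ y ∈ B, (G.Adj x y ↔ H.Adj x y) := by
      intro x hx y hy
      have := congrFun h2 ⟨x, hx⟩
      rw [Subtype.mk.injEq] at this
      have := Finset.ext_iff.1 this y
      simpa [hy, not_iff_not] using this
    have hGH : G = H := by
      ext x y
      by_cases c1 : x ∈ S ∧ y ∈ B
      · exact hadj x c1.1 y c1.2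
      by_cases c2 : y ∈ S ∧ x ∈ B
      · rw [G.adj_comm, H.adj_comm]
        exact hadj y c2.1 x c2.2
      rw [← replaceBetween_adj_of_not (T := T) c1 c2, h1, replaceBetween_adj_of_not c1 c2]
    have hTU : T = U := by
      funext ⟨x, hx⟩
      refine Subtype.ext (Finset.ext fun y => ?_)
      by_cases hy : y ∈ B
      · rw [← replaceBetween_adj_of_mem (G := G) hd hx hy, h1, replaceBetween_adj_of_mem hd hx hy]
      · exact iff_of_false (fun h => hy (Finset.mem_powerset.1 (T ⟨x, hx⟩).2 h))
          (fun h => hy (Finset.mem_powerset.1 (U ⟨x, hx⟩).2 h))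
    subst hGH hTU
    rfl
  have hcard := Nat.card_le_card_of_injective f hf
  rw [Nat.card_prod, Nat.card_prod, Nat.card_coe_set_eq, Nat.card_coe_set_eq] at hcard
  simp only [Nat.card_eq_fintype_card, Fintype.card_fun, Fintype.card_coe,
    Finset.card_powerset] at hcard
  rw [← pow_mul, mul_comm B.card] at hcard
  refine hcard.trans (Nat.mul_le_mul_left _ (Nat.pow_le_pow_left ?_ _))
  exact card_powerset_filter_card_le B m

open Classical in
/-- A graph is rigid for `p` if between distinct fibres of `p` it has many non-edges. -/
def IsRigid {V : Type*} [Fintype V] {w : ℕ} (p : V → Fin w) (G : SimpleGraph V) : Prop :=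
  (∀ b, ∀ S : Finset V, S.card = 2 * w → (∀ v ∈ S, p v ≠ b) → ∀ B : Finset V,
    (∀ v ∈ B, p v = b) → fiberCard p b ≤ w * B.card →
      ∃ v ∈ S, 1 < (B.filter fun u => ¬ G.Adj v u).card) ∧
  ∀ b v, p v ≠ b → w * (2 * w) + 1 < (Finset.univ.filter fun u => p u = b ∧ ¬ G.Adj v u).card

/-- A rigid graph has only one partition into co-matchings, up to renaming the parts. -/
lemma IsRigid.exists_eq_comp {V : Type*} [Fintype V] {w : ℕ} {p q : V → Fin w}
    {G : SimpleGraph V} (hG : IsRigid p G) (hq : G ∈ coMatchingGraphs q)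
    (hlarge : ∀ b, w * (2 * w) ≤ fiberCard p b) : ∃ σ : Fin w → Fin w, q = σ ∘ p := by
  classical
  obtain ⟨h1, h2⟩ := hG
  rw [mem_coMatchingGraphs] at hq
  -- Pigeonhole: some class of `q` holds at least a `1/w` share of the class `b` of `p`.
  have hex : ∀ b, ∃ i, fiberCard p b ≤ w * (Finset.univ.filter fun v => p v = b ∧ q v = i).card := by
    intro b
    by_contra! hc
    have hsum : fiberCard p b = ∑ i, (Finset.univ.filter fun v => p v = b ∧ q v = i).card := by
      rw [fiberCard, Finset.card_eq_sum_card_fiberwise (t := Finset.univ) (f := q)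
        fun _ _ => Finset.mem_coe.2 (Finset.mem_univ _)]
      simp only [Finset.filter_filter]
    have hlt := Finset.sum_lt_sum_of_nonempty (s := Finset.univ) ⟨b, Finset.mem_univ b⟩
      fun i _ => hc i
    rw [← Finset.mul_sum, ← hsum] at hlt
    simp at hlt
  choose σ hσ using hex
  -- With `2 * w` outsiders in the `q`-class `σ b`, the first rigidity condition yields one having
  -- two non-neighbours inside that class, so it is not a co-matching.
  have hout : ∀ b, (Finset.univ.filter fun v => q v = σ b ∧ p v ≠ b).card < 2 * w := by
    intro b
    by_contra! hc
    obtain ⟨S, hS, hcard⟩ := Finset.exists_subset_card_eq hc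
    have hS' : ∀ v ∈ S, q v = σ b ∧ p v ≠ b := fun v hv => by simpa using hS hv
    obtain ⟨v, hv, hlt⟩ := h1 b S hcard (fun v hv => (hS' v hv).2) _ (fun v hv => by
      simp only [Finset.mem_filter] at hv; exact hv.2.1) (hσ b)
    obtain ⟨x, hx, y, hy, hxy⟩ := Finset.one_lt_card.1 hlt
    simp only [Finset.mem_filter, Finset.mem_univ, true_and] at hx hy
    refine hxy (hq v x y ?_ ?_ ?_ ?_ hx.2 hy.2)
    · rw [hx.1.2, (hS' v hv).1]
    · rw [hy.1.2, (hS' v hv).1]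
    · rintro rfl; exact (hS' x hv).2 hx.1.1
    · rintro rfl; exact (hS' y hv).2 hy.1.1
  -- If `σ b = σ b'`, the large share of `b'` would consist of outsiders for `b`, at least `2 * w`
  -- of them by `hlarge`.
  have hinj : Function.Injective σ := by
    intro b b' hbb
    by_contra hne
    have hsub : (Finset.univ.filter fun v => p v = b' ∧ q v = σ b') ⊆
        Finset.univ.filter fun v => q v = σ b ∧ p v ≠ b := by
      intro v hv
      simp only [Finset.mem_filter, Finset.mem_univ, true_and] at hv ⊢
      exact ⟨by rw [hv.2, hbb], by rw [hv.1]; exact Ne.symm hne⟩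
    have hlt := (Finset.card_le_card hsub).trans_lt (hout b)
    have hw : 0 < w := b.pos
    have := (Nat.mul_lt_mul_left hw).2 hlt
    exact absurd ((hlarge b').trans (hσ b')) (not_le.2 this)
  have hsurj : Function.Surjective σ := (Finite.injective_iff_surjective).1 hinj
  have hmiss : ∀ b, (Finset.univ.filter fun v => p v = b ∧ q v ≠ σ b).card ≤ w * (2 * w) := by
    intro b
    have hsub : (Finset.univ.filter fun v => p v = b ∧ q v ≠ σ b) ⊆
        (Finset.univ : Finset (Fin w)).biUnion fun b' =>
          Finset.univ.filter fun v => q v = σ b' ∧ p v ≠ b' := by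
      intro v hv
      simp only [Finset.mem_filter, Finset.mem_univ, true_and, Finset.mem_biUnion] at hv ⊢
      obtain ⟨b', hb'⟩ := hsurj (q v)
      refine ⟨b', hb'.symm, ?_⟩
      rintro rfl
      exact hv.2 (by rw [← hb', hv.1])
    refine (Finset.card_le_card hsub).trans ?_
    simpa using Finset.card_biUnion_le_card_mul Finset.univ _ (2 * w) fun b' _ => (hout b').le
  -- A misplaced `v` has at most `w * (2 * w)` non-neighbours among the vertices of `b` that `q`
  -- puts elsewhere, and at most one among the others. This is the threshold in the second rigidity
  -- condition.
  have hmem : ∀ v b, q v = σ b → p v = b := by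
    intro v b hvb
    by_contra hne
    have hsub : (Finset.univ.filter fun u => p u = b ∧ ¬ G.Adj v u) ⊆
        (Finset.univ.filter fun u => p u = b ∧ q u ≠ σ b) ∪
          Finset.univ.filter fun u => p u = b ∧ q u = σ b ∧ ¬ G.Adj v u := by
      intro u hu
      simp only [Finset.mem_filter, Finset.mem_univ, true_and, Finset.mem_union] at hu ⊢
      tauto
    have hone : (Finset.univ.filter fun u => p u = b ∧ q u = σ b ∧ ¬ G.Adj v u).card ≤ 1 := by
      refine Finset.card_le_one.2 fun x hx y hy => ?_
      simp only [Finset.mem_filter, Finset.mem_univ, true_and] at hx hy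
      refine hq v x y (by rw [hx.2.1, hvb]) (by rw [hy.2.1, hvb]) ?_ ?_ hx.2.2 hy.2.2
      · rintro rfl; exact hne hx.1
      · rintro rfl; exact hne hy.1
    have := (h2 b v hne).trans_le ((Finset.card_le_card hsub).trans (Finset.card_union_le _ _))
    have := hmiss b
    omega
  refine ⟨σ, funext fun v => ?_⟩
  obtain ⟨b, hb⟩ := hsurj (q v)
  rw [Function.comp_apply, hmem v b hb.symm, hb]

/-- All but an exponentially small proportion of the graphs with co-matching fibres are rigid. -/
lemma card_not_isRigid_le {n w L : ℕ} (p : Fin n → Fin w) (hL : ∀ b, L ≤ fiberCard p b) :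
    ({G | G ∈ coMatchingGraphs p ∧ ¬ IsRigid p G}.ncard : ℝ) ≤ (coMatchingGraphs p).ncard *
      ((w : ℝ) * ((n + 1) ^ (4 * w) + (n + 1) ^ (w * (2 * w) + 2)) / 2 ^ L) := by
  classical
  set X : ℝ := ((coMatchingGraphs p).ncard : ℝ) with hX
  let A : Fin w → Finset (Finset (Fin n) × Finset (Fin n)) := fun b =>
    (Finset.univ.filter fun v => p v ≠ b).powersetCard (2 * w) ×ˢ
      (Finset.univ.filter fun v => p v = b).powerset.filter fun B => fiberCard p b ≤ w * B.card
  let E : Fin w → Finset (Fin n) := fun b => Finset.univ.filter fun v => p v ≠ b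
  let F : Fin w → Finset (Fin n) := fun b => Finset.univ.filter fun v => p v = b
  have hcover : {G | G ∈ coMatchingGraphs p ∧ ¬ IsRigid p G} ⊆
      ⋃ b ∈ (Finset.univ : Finset (Fin w)),
        ((⋃ x ∈ A b, sparseComplementGraphs p x.1 x.2 1) ∪
          ⋃ v ∈ E b, sparseComplementGraphs p {v} (F b) (w * (2 * w) + 1)) := by
    rintro G ⟨hG, hr⟩
    simp only [Set.mem_iUnion, Finset.mem_univ, exists_prop, true_and, Set.mem_union]
    rw [IsRigid, not_and_or] at hr
    rcases hr with hr | hr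
    · push Not at hr
      obtain ⟨b, S, hS, hSb, B, hB, hcard, hle⟩ := hr
      refine ⟨b, Or.inl ⟨(S, B), ?_, hG, ?_⟩⟩
      · simp only [A, Finset.mem_product, Finset.mem_powersetCard, Finset.mem_filter,
          Finset.mem_powerset]
        exact ⟨⟨fun v hv => by simpa using hSb v hv, hS⟩, fun v hv => by simpa using hB v hv, hcard⟩
      · intro v hv
        convert hle v hv
    · push Not at hr
      obtain ⟨b, v, hv, hle⟩ := hr
      refine ⟨b, Or.inr ⟨v, by simpa [E] using hv, hG, ?_⟩⟩
      intro u hu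
      rw [Finset.mem_singleton] at hu
      subst hu
      simp only [F, Finset.filter_filter]
      convert hle
  have hbound : ∀ (S B : Finset (Fin n)) (m : ℕ), (∀ s ∈ S, ∀ b ∈ B, p s ≠ p b) →
      ((sparseComplementGraphs p S B m).ncard : ℝ) ≤
        X * (n + 1) ^ (m * S.card) / 2 ^ (S.card * B.card) := by
    intro S B m hSB
    rw [le_div_iff₀ (by positivity)]
    have h := card_sparseComplementGraphs_mul_le p S B m hSB
    have hB : B.card + 1 ≤ n + 1 := by simpa using Finset.card_le_univ B
    have h' := h.trans (Nat.mul_le_mul_left _ (Nat.pow_le_pow_left (Nat.pow_le_pow_left hB m) _))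
    rw [← pow_mul] at h'
    rw [hX]
    exact_mod_cast h'
  have hX0 : 0 ≤ X := by positivity
  -- There are at most `(n + 1) ^ (2w) * 2 ^ k_b` pairs `(S, B)`, with `k_b` the size of class `b`.
  -- As `|S| = 2w` and `w |B| ≥ k_b`, each pair has proportion at most `(n + 1) ^ (2w) / 2 ^ (2
  -- k_b)`, which beats the number of choices of `B`.
  have hA : ∀ b, ((⋃ x ∈ A b, sparseComplementGraphs p x.1 x.2 1).ncard : ℝ) ≤
      X * ((n + 1) ^ (4 * w) / 2 ^ L) := by
    intro b
    have hterm : ∀ x ∈ A b, ((sparseComplementGraphs p x.1 x.2 1).ncard : ℝ) ≤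
        X * (n + 1) ^ (2 * w) / 2 ^ (2 * fiberCard p b) := by
      rintro ⟨S, B⟩ hx
      simp only [A, Finset.mem_product, Finset.mem_powersetCard, Finset.mem_filter,
        Finset.mem_powerset] at hx
      obtain ⟨⟨hS, hScard⟩, hB, hcard⟩ := hx
      refine (hbound S B 1 ?_).trans ?_
      · intro s hs u hu
        have := hS hs
        have := hB hu
        simp_all
      · rw [hScard, one_mul]
        refine div_le_div_of_nonneg_left (by positivity) (by positivity) ?_
        refine pow_le_pow_right₀ (by norm_num) ?_
        nlinarith
    have hcardA : ((A b).card : ℝ) ≤ (n + 1) ^ (2 * w) * 2 ^ fiberCard p b := by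
      have h1 : (A b).card ≤ n ^ (2 * w) * 2 ^ fiberCard p b := by
        rw [Finset.card_product, Finset.card_powersetCard]
        refine Nat.mul_le_mul ((Nat.choose_le_pow _ _).trans (Nat.pow_le_pow_left ?_ _))
          ((Finset.card_filter_le _ _).trans (by rw [Finset.card_powerset]; rfl))
        simpa using Finset.card_le_univ (Finset.univ.filter fun v => p v ≠ b)
      calc ((A b).card : ℝ) ≤ (n : ℝ) ^ (2 * w) * 2 ^ fiberCard p b := by exact_mod_cast h1
        _ ≤ _ := by gcongr; linarith
    calc ((⋃ x ∈ A b, sparseComplementGraphs p x.1 x.2 1).ncard : ℝ)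
        ≤ ∑ x ∈ A b, ((sparseComplementGraphs p x.1 x.2 1).ncard : ℝ) := by
          exact_mod_cast Finset.set_ncard_biUnion_le _ _
      _ ≤ (A b).card * (X * (n + 1) ^ (2 * w) / 2 ^ (2 * fiberCard p b)) := by
          rw [← nsmul_eq_mul]
          exact Finset.sum_le_card_nsmul _ _ _ hterm
      _ ≤ ((n + 1) ^ (2 * w) * 2 ^ fiberCard p b) *
          (X * (n + 1) ^ (2 * w) / 2 ^ (2 * fiberCard p b)) := by gcongr
      _ = X * ((n + 1) ^ (4 * w) / 2 ^ fiberCard p b) := by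
          rw [two_mul (fiberCard p b), pow_add, show 4 * w = 2 * w + 2 * w by ring, pow_add]
          field_simp
      _ ≤ _ := by
          gcongr
          exacts [by norm_num, hL b]
  have hE : ∀ b, ((⋃ v ∈ E b, sparseComplementGraphs p {v} (F b) (w * (2 * w) + 1)).ncard : ℝ) ≤
      X * ((n + 1) ^ (w * (2 * w) + 2) / 2 ^ L) := by
    intro b
    have hterm : ∀ v ∈ E b, ((sparseComplementGraphs p {v} (F b) (w * (2 * w) + 1)).ncard : ℝ) ≤
        X * (n + 1) ^ (w * (2 * w) + 1) / 2 ^ L := by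
      intro v hv
      refine (hbound {v} (F b) _ ?_).trans ?_
      · intro s hs u hu
        simp only [E, F, Finset.mem_filter, Finset.mem_univ, true_and,
          Finset.mem_singleton] at hv hs hu
        rw [hs, hu]
        exact hv
      · rw [Finset.card_singleton, mul_one, one_mul]
        refine div_le_div_of_nonneg_left (by positivity) (by positivity) ?_
        exact pow_le_pow_right₀ (by norm_num) (hL b)
    have hcardE : ((E b).card : ℝ) ≤ n + 1 := by
      have h : (E b).card ≤ n := by simpa using Finset.card_le_univ (E b)
      have : ((E b).card : ℝ) ≤ n := by exact_mod_cast h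
      linarith
    calc _ ≤ ∑ v ∈ E b, ((sparseComplementGraphs p {v} (F b) (w * (2 * w) + 1)).ncard : ℝ) := by
          exact_mod_cast Finset.set_ncard_biUnion_le _ _
      _ ≤ (E b).card * (X * (n + 1) ^ (w * (2 * w) + 1) / 2 ^ L) := by
          rw [← nsmul_eq_mul]
          exact Finset.sum_le_card_nsmul _ _ _ hterm
      _ ≤ (n + 1) * (X * (n + 1) ^ (w * (2 * w) + 1) / 2 ^ L) := by gcongr
      _ = _ := by ring
  calc _ ≤ ∑ b : Fin w, ((((⋃ x ∈ A b, sparseComplementGraphs p x.1 x.2 1) ∪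
          ⋃ v ∈ E b, sparseComplementGraphs p {v} (F b) (w * (2 * w) + 1)).ncard : ℕ) : ℝ) := by
        exact_mod_cast (Set.ncard_le_ncard hcover (Set.toFinite _)).trans
          (Finset.set_ncard_biUnion_le _ _)
    _ ≤ ∑ b : Fin w, (X * ((n + 1) ^ (4 * w) / 2 ^ L) +
          X * ((n + 1) ^ (w * (2 * w) + 2) / 2 ^ L)) := by
        refine Finset.sum_le_sum fun b _ => le_trans ?_ (add_le_add (hA b) (hE b))
        exact_mod_cast Set.ncard_union_le _ _
    _ = _ := by
        rw [Finset.sum_const, Finset.card_univ, Fintype.card_fin, nsmul_eq_mul]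
        ring

/-! ### The lower bound from balanced partitions. -/

/-- Some map splits `n` points into `w` nearly equal parts. -/
lemma exists_balanced {w : ℕ} (hw : 1 ≤ w) (n : ℕ) :
    ∃ p : Fin n → Fin w, ∀ b, n / w ≤ fiberCard p b ∧ fiberCard p b ≤ n / w + 1 := by
  refine ⟨fun v => ⟨v % w, Nat.mod_lt _ hw⟩, fun b => ?_⟩
  have h : fiberCard (fun v : Fin n => (⟨v % w, Nat.mod_lt _ hw⟩ : Fin w)) b =
      Nat.count (fun x => x ≡ b [MOD w]) n := by
    rw [Nat.count_eq_card_filter_range, fiberCard]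
    refine Finset.card_bij (fun v _ => (v : ℕ)) ?_ (fun _ _ _ _ h => Fin.ext h) ?_
    · intro v hv
      have := congrArg Fin.val (Finset.mem_filter.1 hv).2
      simp only [Finset.mem_filter, Finset.mem_range, Nat.ModEq, Nat.mod_eq_of_lt b.2]
      exact ⟨v.2, this⟩
    · intro x hx
      simp only [Finset.mem_filter, Finset.mem_range, Nat.ModEq, Nat.mod_eq_of_lt b.2] at hx
      exact ⟨⟨x, hx.1⟩, by simp [hx.2], rfl⟩
  rw [h, Nat.count_modEq_card n hw]
  split_ifs <;> omega

/-- Double counting: if `G` is rigid for one `p` of this type, every other map of the type that it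
is counted for is `σ ∘ p` for one of the `w ^ w` maps `σ`. -/
lemma card_filter_isRigid_le {n w : ℕ} (p₀ : Fin n → Fin w)
    (hlarge : ∀ b, w * (2 * w) ≤ fiberCard p₀ b) :
    ∑ p ∈ Finset.univ.filter (fun p : Fin n → Fin w => fiberCard p = fiberCard p₀),
      {G | G ∈ coMatchingGraphs p ∧ IsRigid p G}.ncard ≤
        w ^ w * coMatchingPartitionableCount w n := by
  classical
  set P := Finset.univ.filter (fun p : Fin n → Fin w => fiberCard p = fiberCard p₀) with hP
  let U : Finset (SimpleGraph (Fin n)) :=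
    {G : SimpleGraph (Fin n) | CoMatchingPartitionable w G}.toFinset
  have hU : coMatchingPartitionableCount w n = U.card := Set.ncard_eq_toFinset_card' _
  have h1 : ∀ p : Fin n → Fin w, {G | G ∈ coMatchingGraphs p ∧ IsRigid p G}.ncard =
      (U.filter fun G => G ∈ coMatchingGraphs p ∧ IsRigid p G).card := by
    intro p
    rw [← Set.ncard_coe_finset]
    congr 1
    ext G
    simp only [U, Finset.coe_filter, Set.mem_toFinset]
    exact ⟨fun h => ⟨⟨p, h.1⟩, h⟩, fun h => h.2⟩
  rw [Finset.sum_congr rfl fun p _ => h1 p, hU]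
  simp only [Finset.card_filter]
  rw [Finset.sum_comm, mul_comm, ← smul_eq_mul]
  refine Finset.sum_le_card_nsmul _ _ _ fun G _ => ?_
  rw [← Finset.card_filter]
  rcases (P.filter fun p => G ∈ coMatchingGraphs p ∧ IsRigid p G).eq_empty_or_nonempty with he | hne
  · rw [he]; simp
  obtain ⟨p, hp⟩ := hne
  simp only [hP, Finset.mem_filter, Finset.mem_univ, true_and] at hp
  have hsub : (P.filter fun p => G ∈ coMatchingGraphs p ∧ IsRigid p G) ⊆
      (Finset.univ : Finset (Fin w → Fin w)).image fun σ => σ ∘ p := by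
    intro q hq
    simp only [Finset.mem_filter] at hq
    obtain ⟨σ, hσ⟩ := hp.2.2.exists_eq_comp hq.2.1 (by rw [hp.1]; exact hlarge)
    exact Finset.mem_image.2 ⟨σ, Finset.mem_univ _, hσ.symm⟩
  refine (Finset.card_le_card hsub).trans (Finset.card_image_le.trans ?_)
  simp

/-- A polynomial in `n` is at most a polynomial in `m = n / w` (division in `ℕ`), through `n + 1 ≤ w
(m + 1)`, and `2 ^ m` outgrows it. -/
lemma eventually_exceptional_le (w : ℕ) (hw : 1 ≤ w) : ∀ᶠ n : ℕ in atTop,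
    (w : ℝ) * ((n + 1) ^ (4 * w) + (n + 1) ^ (w * (2 * w) + 2)) / 2 ^ (n / w) ≤ 1 / 2 := by
  set K := 4 * w + (w * (2 * w) + 2) with hK
  have hlim : Tendsto (fun m : ℕ => (m : ℝ) ^ K / 2 ^ m) atTop (nhds 0) :=
    tendsto_pow_const_div_const_pow_of_one_lt K (by norm_num)
  have hlim2 : Tendsto (fun m : ℕ => (2 * w * (w : ℝ) ^ K * 2) * (((m + 1 : ℕ) : ℝ) ^ K / 2 ^ (m + 1)))
      atTop (nhds 0) := by
    simpa using (hlim.comp (tendsto_add_atTop_nat 1)).const_mul (2 * w * (w : ℝ) ^ K * 2)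
  have hdiv : Tendsto (fun n : ℕ => n / w) atTop atTop := Nat.tendsto_div_const_atTop (by omega)
  filter_upwards [hdiv.eventually (hlim2.eventually_le_const (show (0 : ℝ) < 1 / 2 by norm_num))]
    with n hn
  refine le_trans ?_ hn
  have h1 : n + 1 ≤ w * (n / w + 1) := by
    have := Nat.lt_mul_div_succ n (show 0 < w by omega)
    omega
  have h1' : (n : ℝ) + 1 ≤ w * ((n / w + 1 : ℕ) : ℝ) := by exact_mod_cast h1
  have hn1 : (1 : ℝ) ≤ n + 1 := by linarith [Nat.cast_nonneg (α := ℝ) n]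
  have h2 : ((n : ℝ) + 1) ^ (4 * w) ≤ (n + 1) ^ K := pow_le_pow_right₀ hn1 (by omega)
  have h3 : ((n : ℝ) + 1) ^ (w * (2 * w) + 2) ≤ (n + 1) ^ K := pow_le_pow_right₀ hn1 (by omega)
  calc _ ≤ (w : ℝ) * ((n + 1) ^ K + (n + 1) ^ K) / 2 ^ (n / w) := by gcongr
    _ = (2 * w) * (n + 1) ^ K / 2 ^ (n / w) := by ring
    _ ≤ (2 * w) * (w * ((n / w + 1 : ℕ) : ℝ)) ^ K / 2 ^ (n / w) := by gcongr
    _ = _ := by rw [mul_pow, pow_succ]; field_simp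

lemma le_coMatchingPartitionableCount (w : ℕ) (hw : 1 ≤ w) : ∃ c : ℝ, 0 < c ∧
    ∀ᶠ n : ℕ in atTop, c * unsimplifiedRate w n ≤ coMatchingPartitionableCount w n := by
  classical
  obtain ⟨c, hc, h⟩ := le_matchingCount_div_factorial
  have hw' : (0 : ℝ) < w := by exact_mod_cast hw
  -- Each `1 / 2` in the power bounds the Gaussian factor of a class; the `2` in the denominator is
  -- the loss to non-rigid graphs, and `w ^ w` the multiplicity of a graph.
  refine ⟨(c * (1 / 2)) ^ w / (2 * w ^ w), by positivity, ?_⟩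
  have hdiv : Tendsto (fun n : ℕ => n / w) atTop atTop := Nat.tendsto_div_const_atTop (by omega)
  filter_upwards [eventually_exceptional_le w hw, hdiv.eventually_ge_atTop (w * (2 * w)),
    eventually_ge_atTop w] with n hexc hlarge hnw
  have hn' : (0 : ℝ) < n := by exact_mod_cast (show 0 < n by omega)
  obtain ⟨p₀, hp₀⟩ := exists_balanced hw n
  set P := Finset.univ.filter (fun p : Fin n → Fin w => fiberCard p = fiberCard p₀) with hP
  set a : ℝ := n / w with ha
  have ha1 : 1 ≤ a := by rw [ha, one_le_div hw']; exact_mod_cast hnw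
  set Q : ℝ := (2 : ℝ) ^ ((1 - 1 / (w : ℝ)) * ((n : ℝ) ^ 2 / 2)) with hQ
  set R : ℝ := Real.exp (classExponent a) / Real.sqrt a with hR
  have hR0 : 0 < R := by have := Real.sqrt_pos.2 (zero_lt_one.trans_le ha1); positivity
  have hdist : ∀ b, |(fiberCard p₀ b : ℝ) - a| ≤ 1 := by
    intro b
    have e1 : ((n / w : ℕ) : ℝ) ≤ a := Nat.cast_div_le
    have e2 : a ≤ (n / w : ℕ) + 1 := by
      rw [ha, div_le_iff₀' hw']
      have := Nat.lt_mul_div_succ n (show 0 < w by omega)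
      exact_mod_cast this.le
    have e3 : ((n / w : ℕ) : ℝ) ≤ fiberCard p₀ b := by exact_mod_cast (hp₀ b).1
    have e4 : (fiberCard p₀ b : ℝ) ≤ (n / w : ℕ) + 1 := by exact_mod_cast (hp₀ b).2
    rw [abs_le]
    constructor <;> linarith
  set X : ℝ := ((coMatchingGraphs p₀).ncard : ℝ) with hX
  -- at least half of the graphs are rigid, for each partition of this type
  have hgood : ∀ p ∈ P, X / 2 ≤ ({G | G ∈ coMatchingGraphs p ∧ IsRigid p G}.ncard : ℝ) := by
    intro p hp
    have hpk : fiberCard p = fiberCard p₀ := (Finset.mem_filter.1 hp).2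
    have hXp : ((coMatchingGraphs p).ncard : ℝ) = X := by
      rw [hX, cast_ncard_coMatchingGraphs hw, cast_ncard_coMatchingGraphs hw, hpk]
    have hbad := card_not_isRigid_le p (L := n / w) fun b => by rw [hpk]; exact (hp₀ b).1
    rw [hXp] at hbad
    have hcov : coMatchingGraphs p ⊆ {G | G ∈ coMatchingGraphs p ∧ IsRigid p G} ∪
        {G | G ∈ coMatchingGraphs p ∧ ¬ IsRigid p G} := fun G hG => by
      by_cases hr : IsRigid p G
      exacts [Or.inl ⟨hG, hr⟩, Or.inr ⟨hG, hr⟩]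
    have hle : ((coMatchingGraphs p).ncard : ℝ) ≤
        {G | G ∈ coMatchingGraphs p ∧ IsRigid p G}.ncard +
        {G | G ∈ coMatchingGraphs p ∧ ¬ IsRigid p G}.ncard := by
      exact_mod_cast (Set.ncard_le_ncard hcov (Set.toFinite _)).trans (Set.ncard_union_le _ _)
    rw [hXp] at hle
    have := mul_le_mul_of_nonneg_left hexc (show 0 ≤ X by positivity)
    linarith
  have hcount : (P.card : ℝ) * (X / 2) ≤ (w : ℝ) ^ w * coMatchingPartitionableCount w n := by
    have h1 := card_filter_isRigid_le p₀ fun b => hlarge.trans (hp₀ b).1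
    have h2 : ∑ p ∈ P, ({G | G ∈ coMatchingGraphs p ∧ IsRigid p G}.ncard : ℝ) ≤
        (w : ℝ) ^ w * coMatchingPartitionableCount w n := by exact_mod_cast h1
    rw [← nsmul_eq_mul]
    exact (Finset.card_nsmul_le_sum _ _ _ hgood).trans h2
  have hfac : (P.card : ℝ) * ∏ i, ((fiberCard p₀ i).factorial : ℝ) = n.factorial := by
    have := card_fiberCard_eq_mul p₀
    rw [Fintype.card_fin] at this
    exact_mod_cast this
  -- The computation of the upper bound reversed for the single balanced size vector: every size is
  -- within one of `a`, where the tangent bound is sharp up to a constant.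
  have hmain : n.factorial * Q * (c * (1 / 2) * R) ^ w ≤ P.card * X := by
    rw [hX, cast_ncard_coMatchingGraphs hw, ← hfac]
    calc (P.card : ℝ) * (∏ i, ((fiberCard p₀ i).factorial : ℝ)) * Q * (c * (1 / 2) * R) ^ w
        = P.card * Q * (∏ i, ((fiberCard p₀ i).factorial : ℝ)) *
          ∏ i, (c * (1 / 2) * R * Real.exp (classSlope a * (fiberCard p₀ i - a))) := by
          rw [Finset.prod_mul_distrib, Finset.prod_const, ← Real.exp_sum, sum_classSlope hw p₀,
            Real.exp_zero, mul_one, Finset.card_univ, Fintype.card_fin]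
          ring
      _ ≤ P.card * Q * (∏ i, ((fiberCard p₀ i).factorial : ℝ)) *
          ∏ i, ((matchingCount (fiberCard p₀ i) : ℝ) / (fiberCard p₀ i).factorial *
            (2 : ℝ) ^ (-((fiberCard p₀ i : ℝ) - a) ^ 2 / 2)) := by
          refine mul_le_mul_of_nonneg_left (Finset.prod_le_prod (fun i _ => by positivity)
            fun i _ => ?_) (by positivity)
          have h2 : (1 / 2 : ℝ) ≤ (2 : ℝ) ^ (-((fiberCard p₀ i : ℝ) - a) ^ 2 / 2) := by
            rw [one_div, ← Real.rpow_neg_one]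
            refine Real.rpow_le_rpow_of_exponent_le (by norm_num) ?_
            have := hdist i
            rw [← sq_le_one_iff_abs_le_one] at this
            linarith
          calc _ = (c * R * Real.exp (classSlope a * (fiberCard p₀ i - a))) * (1 / 2) := by ring
            _ ≤ _ := mul_le_mul (h a _ ha1 (hdist i)) h2 (by norm_num) (by positivity)
      _ = P.card * (Q * ∏ i, ((matchingCount (fiberCard p₀ i) : ℝ) *
            (2 : ℝ) ^ (-((fiberCard p₀ i : ℝ) - a) ^ 2 / 2))) := by
          rw [mul_assoc (P.card * Q), ← Finset.prod_mul_distrib, mul_assoc]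
          congr 2
          refine Finset.prod_congr rfl fun i _ => ?_
          field_simp
  rw [div_mul_eq_mul_div, div_le_iff₀ (by positivity), unsimplifiedRate, ← ha, ← hR, ← hQ]
  calc _ = n.factorial * Q * (c * (1 / 2) * R) ^ w := by ring
    _ ≤ P.card * X := hmain
    _ ≤ _ := by linarith

theorem mainTheorem11 (w : ℕ) (hw : 1 ≤ w) :
    (fun n : ℕ => (coMatchingPartitionableCount w n : ℝ)) =Θ[atTop]
      (fun n : ℕ =>
        (w : ℝ) ^ n / (n : ℝ) ^ (((w : ℝ) - 1) / 2)
          * ((n : ℝ) / (Real.exp 1 * (w : ℝ))) ^ ((n : ℝ) / 2)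
          * Real.exp (Real.sqrt ((n : ℝ) * (w : ℝ)))
          * (2 : ℝ) ^ ((1 - 1 / (w : ℝ)) * ((n : ℝ) ^ 2 / 2))) := by
  refine IsTheta.trans ?_ (unsimplifiedRate_isTheta w hw)
  have hpos : ∀ n, 0 ≤ unsimplifiedRate w n := fun n => by unfold unsimplifiedRate; positivity
  obtain ⟨C, hC, hupper⟩ := coMatchingPartitionableCount_le w hw
  obtain ⟨c, hc, hlower⟩ := le_coMatchingPartitionableCount w hw
  constructor
  · refine IsBigO.of_bound C ?_
    filter_upwards [eventually_ge_atTop 1] with n hn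
    rw [Real.norm_of_nonneg (hpos n), Real.norm_of_nonneg (Nat.cast_nonneg _)]
    exact hupper n hn
  · refine IsBigO.of_bound c⁻¹ ?_
    filter_upwards [hlower] with n hn
    rw [Real.norm_of_nonneg (hpos n), Real.norm_of_nonneg (Nat.cast_nonneg _),
      ← div_eq_inv_mul, le_div_iff₀' hc]
    exact hn
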